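/- Let $\mathbb T$ be the set of locally finite rooted ordered trees, with the metric of local convergence $\delta(\mathbf t,\mathbf t')=2^{-\sup\{h\,:\,r_h(\mathbf t)=r_h(\mathbf t')\}}$, where $r_h(\mathbf t)$ is the restriction of $\mathbf t$ to its vertices at height at most $h$, and with its Borel $\sigma$-field. Let $p=(p(n))_{n\in\mathbb N}$ be a probability distribution on $\mathbb N$ with \[ 0<p(0)<1,\qquad p(0)+p(1)<1,\qquad \sum_{n} n\,p(n)=1, \] and let $d=\max\{k:\ \sum_{n\in k\mathbb N}p(n)=1\}$ be its period. Let $\tau$ be a Galton–Watson tree with offspring distribution $p$: a $\mathbb T$-valued random variable such that the number of children of the root has law $p$ and, conditionally on this number being $n\ge 1$, the subtrees above the $n$ children of the root are independent and distributed as $\tau$. Let $|\tau|$ be its number of vertices. Let $\tau^*$ be a Kesten's tree associated to $p$: the two-type Galton–Watson tree whose root is special, in which a normal individual produces only normal individuals according to $p$, and a special individual produces $n$ individuals with probability $p^*(n)=n\,p(n)/m$, where $m=\sum_k k\,p(k)$ $(=1)$, of which one, chosen uniformly at random, is special and the others are normal. Then: 1. $\mathbb P(|\tau|\in[n,n+d))>0$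 for all $n$ large enough, and if $(\tau_n)$ is a sequence of random trees such that, for all $n$ large enough, $\tau_n$ is distributed as $\tau$ conditionally on $\{|\tau|\in[n,n+d)\}$, then $\tau_n\to\tau^*$ in distribution in $(\mathbb T,\delta)$ as $n\to\infty$. 2. $\mathbb P(|\tau|\ge n)>0$ for all $n$, and if $(\tau_n)$ is a sequence of random trees such that, for all $n$ large enough, $\tau_n$ is distributed as $\tau$ conditionally on $\{|\tau|\ge n\}$, then $\tau_n\to\tau^*$ in distribution in $(\mathbb T,\delta)$ as $n\to\infty$. -/

import Mathlib

open MeasureTheory ProbabilityTheory Filter Topology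
open scoped ENNReal

/-- A locally finite rooted ordered tree in Neveu's formalism.  A vertex is a finite word
`u = [u₁, …, uₙ]`; the root is the empty word `[]` and the children of `u` are the words
`u ++ [i]`, in the order of `i`.  Letters are natural numbers starting from `0`, so the vertex `u`
has `k` children exactly when these are `u ++ [0], …, u ++ [k - 1]`. -/
@[ext]
structure PlaneTree where
  verts : Set (List ℕ)
  root_mem : [] ∈ verts
  ancestor_mem : ∀ u v : List ℕ, u ++ v ∈ verts → u ∈ verts
  exists_children : ∀ u ∈ verts, ∃ k : ℕ, ∀ i : ℕ, u ++ [i] ∈ verts ↔ i < k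

namespace PlaneTree

/-- The number of children `k_u(t)` of the vertex `u` of `t` (only used for `u ∈ t`). -/
noncomputable def outdegree (t : PlaneTree) (u : List ℕ) : ℕ :=
  {i : ℕ | u ++ [i] ∈ t.verts}.ncard

/-- The total progeny `|t|`, the number of vertices (possibly infinite). -/
noncomputable def size (t : PlaneTree) : ℕ∞ := t.verts.encard

/-- The tree reduced to its root. -/
def trivial : PlaneTree where
  verts := {[]}
  root_mem := rfl
  ancestor_mem u v h := (List.append_eq_nil_iff.1 h).1
  exists_children u _ := ⟨0, fun i => by simp⟩

/-- The sub-tree `S_u(t) = {v | u v ∈ t}` of `t` above the vertex `u ∈ t`.  When `u` is not a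
vertex of `t` the value is the trivial tree (this value is never used). -/
noncomputable def subtree (t : PlaneTree) (u : List ℕ) : PlaneTree :=
  open Classical in
  if h : u ∈ t.verts then
    { verts := {v | u ++ v ∈ t.verts}
      root_mem := by simpa using h
      ancestor_mem := fun v w hvw =>
        t.ancestor_mem (u ++ v) w (by simpa [List.append_assoc] using hvw)
      exists_children := fun v hv => by
        obtain ⟨k, hk⟩ := t.exists_children (u ++ v) hv
        exact ⟨k, fun i => by simpa [List.append_assoc] using hk i⟩ }
  else trivial

/-- The restriction `r_h(t) = {u ∈ t | |u| ≤ h}`. -/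
def restrict (h : ℕ) (t : PlaneTree) : PlaneTree where
  verts := {u | u ∈ t.verts ∧ u.length ≤ h}
  root_mem := ⟨t.root_mem, by simp⟩
  ancestor_mem u v huv := ⟨t.ancestor_mem u v huv.1, by
    have := huv.2
    rw [List.length_append] at this
    omega⟩
  exists_children u hu := by
    obtain ⟨k, hk⟩ := t.exists_children u hu.1
    by_cases hlt : u.length < h
    · refine ⟨k, fun i => ?_⟩
      rw [← hk i]
      simp only [Set.mem_ofPred_eq, List.length_append, List.length_singleton, and_iff_left_iff_imp]
      omega
    · refine ⟨0, fun i => ?_⟩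
      simp only [Set.mem_ofPred_eq, List.length_append, List.length_singleton]
      omega

theorem restrict_mono {t t' : PlaneTree} {h k : ℕ} (hk : k ≤ h)
    (e : restrict h t = restrict h t') : restrict k t = restrict k t' := by
  ext u
  have := congrArg (fun s => u ∈ s.verts) e
  simp only [restrict, Set.mem_ofPred_eq, eq_iff_iff] at this ⊢
  constructor
  · rintro ⟨a, b⟩
    exact ⟨(this.1 ⟨a, b.trans hk⟩).1, b⟩
  · rintro ⟨a, b⟩
    exact ⟨(this.2 ⟨a, b.trans hk⟩).1, b⟩

theorem restrict_zero (t t' : PlaneTree) : restrict 0 t = restrict 0 t' := by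
  ext u
  simp only [restrict, Set.mem_ofPred_eq, nonpos_iff_eq_zero, List.length_eq_zero_iff]
  constructor
  · rintro ⟨_, rfl⟩
    exact ⟨t'.root_mem, rfl⟩
  · rintro ⟨_, rfl⟩
    exact ⟨t.root_mem, rfl⟩

theorem bddAbove_restrict_eq {t t' : PlaneTree} (hne : t ≠ t') :
    BddAbove {h : ℕ | restrict h t = restrict h t'} := by
  by_contra hb
  apply hne
  ext u
  rw [not_bddAbove_iff] at hb
  obtain ⟨h, hh, hu⟩ := hb u.length
  have := congrArg (fun s => u ∈ s.verts) (show restrict h t = restrict h t' from hh)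
  simpa [restrict, hu.le] using this

/-- The distance `d(t, t') = 2 ^ (- sup {h | r_h(t) = r_h(t')})`, which is `0` if `t = t'` (the
supremum is then infinite). -/
noncomputable instance : Dist PlaneTree where
  dist t t' :=
    open Classical in
    if t = t' then 0 else (2⁻¹ : ℝ) ^ sSup {h : ℕ | restrict h t = restrict h t'}

theorem dist_eq {t t' : PlaneTree} (hne : t ≠ t') :
    dist t t' = (2⁻¹ : ℝ) ^ sSup {h : ℕ | restrict h t = restrict h t'} := by
  exact if_neg hne

theorem tree_dist_self (t : PlaneTree) : dist t t = 0 := by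
  exact if_pos rfl

theorem dist_ultra (t₁ t₂ t₃ : PlaneTree) : dist t₁ t₃ ≤ max (dist t₁ t₂) (dist t₂ t₃) := by
  by_cases h12 : t₁ = t₂
  · subst h12
    exact le_max_right _ _
  by_cases h23 : t₂ = t₃
  · subst h23
    exact le_max_left _ _
  by_cases h13 : t₁ = t₃
  · subst h13
    rw [tree_dist_self, dist_eq h12]
    exact le_max_of_le_left (by positivity)
  rw [dist_eq h12, dist_eq h23, dist_eq h13]
  have m12 := Nat.sSup_mem ⟨0, restrict_zero t₁ t₂⟩ (bddAbove_restrict_eq h12)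
  have m23 := Nat.sSup_mem ⟨0, restrict_zero t₂ t₃⟩ (bddAbove_restrict_eq h23)
  simp only [Set.mem_ofPred_eq] at m12 m23
  set a := sSup {h : ℕ | restrict h t₁ = restrict h t₂}
  set b := sSup {h : ℕ | restrict h t₂ = restrict h t₃}
  have hle : min a b ≤ sSup {h : ℕ | restrict h t₁ = restrict h t₃} :=
    le_csSup (bddAbove_restrict_eq h13)
      ((restrict_mono (min_le_left a b) m12).trans (restrict_mono (min_le_right a b) m23))
  refine (pow_le_pow_of_le_one (by norm_num) (by norm_num) hle).trans ?_
  rcases min_choice a b with h | h <;> rw [h]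
  · exact le_max_left _ _
  · exact le_max_right _ _

/-- The metric of local convergence. -/
noncomputable instance : MetricSpace PlaneTree where
  dist_self := tree_dist_self
  dist_comm t t' := by
    by_cases h : t = t'
    · rw [h]
    · rw [dist_eq h, dist_eq (Ne.symm h)]
      simp only [eq_comm]
  dist_triangle t₁ t₂ t₃ := by
    have nn : ∀ t t' : PlaneTree, 0 ≤ dist t t' := fun t t' => by
      by_cases h : t = t'
      · rw [h, tree_dist_self]
      · rw [dist_eq h]
        positivity
    exact (dist_ultra t₁ t₂ t₃).trans (max_le_add_of_nonneg (nn _ _) (nn _ _))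
  eq_of_dist_eq_zero := by
    intro t t' h
    by_contra hne
    rw [dist_eq hne] at h
    exact absurd h (by positivity)

/-- The space of trees carries the Borel `σ`-field of the local metric. -/
noncomputable instance : MeasurableSpace PlaneTree := borel PlaneTree

instance : BorelSpace PlaneTree := ⟨rfl⟩

end PlaneTree

/-- The mean `∑ n p(n)` of a probability distribution on `ℕ`. -/
noncomputable def offspringMean (p : PMF ℕ) : ℝ≥0∞ := ∑' n : ℕ, (n : ℝ≥0∞) * p n

/-- The period `max {k | ℙ(ζ ∈ k ℕ) = 1}` of the law `p` of `ζ` (the set is bounded, so that the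
supremum is a maximum, as soon as `p(0) < 1`). -/
noncomputable def offspringPeriod (p : PMF ℕ) : ℕ :=
  sSup {k : ℕ | p.toMeasure {n : ℕ | k ∣ n} = 1}

/-- The size-biased distribution `p*(n) = n p(n) / m`. -/
noncomputable def sizeBiased (p : PMF ℕ) (n : ℕ) : ℝ≥0∞ := (n : ℝ≥0∞) * p n / offspringMean p

/-- Under `P`, `τ` is a Galton–Watson tree with offspring distribution `p`: the number of children
of the root has law `p`, and conditionally on this number being `n ≥ 1`, the sub-trees above the
`n` children of the root are independent and distributed as `τ`. -/
structure IsGaltonWatson {Ω : Type*} [MeasurableSpace Ω] (p : PMF ℕ) (τ : Ω → PlaneTree)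
    (P : Measure Ω) : Prop where
  aemeasurable : AEMeasurable τ P
  offspring : ∀ n : ℕ, P {ω | (τ ω).outdegree [] = n} = p n
  branching : ∀ n : ℕ, 1 ≤ n → P {ω | (τ ω).outdegree [] = n} ≠ 0 →
    iIndepFun (fun (i : Fin n) (ω : Ω) => (τ ω).subtree [(i : ℕ)])
        (P[|{ω | (τ ω).outdegree [] = n}]) ∧
      ∀ i : Fin n, IdentDistrib (fun ω => (τ ω).subtree [(i : ℕ)]) τ
        (P[|{ω | (τ ω).outdegree [] = n}]) P

/-- A tree whose individuals are either special or normal, given by the tree and the set of its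
special individuals. -/
abbrev TypedTree : Type := PlaneTree × Set (List ℕ)

/-- The sub-tree above `u` of a typed tree, where the individuals keep their types. -/
noncomputable def TypedTree.subtree (x : TypedTree) (u : List ℕ) : TypedTree :=
  (PlaneTree.subtree x.1 u, {v | u ++ v ∈ x.2})

/-- The root of `x` has `n` children, of which the one with index `i` is special and the others are
normal. -/
def TypedTree.RootOffspring (x : TypedTree) (n i : ℕ) : Prop :=
  x.1.outdegree [] = n ∧ ∀ j < n, ([j] ∈ x.2 ↔ j = i)

/-- Under `P`, `X` is the two-type Galton–Watson tree started from a normal individual: all its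
individuals are normal, and they reproduce according to `p`. -/
structure IsNormalTypedTree {Ω : Type*} [MeasurableSpace Ω] (p : PMF ℕ) (X : Ω → TypedTree)
    (P : Measure Ω) : Prop where
  galtonWatson : IsGaltonWatson p (fun ω => (X ω).1) P
  normal : ∀ᵐ ω ∂P, (X ω).2 = ∅

/-- Under `P`, `X` is the two-type Galton–Watson tree started from a special individual: the root
is special; its number of children has the size-biased law `p*`, one of the children, chosen
uniformly, is special and the others are normal; conditionally on the number of children and their
types, the typed sub-trees above the children are independent, the one above the special child is
distributed as `X` and those above the normal children are started from a normal individual. -/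
structure IsSpecialTypedTree {Ω : Type*} [MeasurableSpace Ω] (p : PMF ℕ) (X : Ω → TypedTree)
    (P : Measure Ω) : Prop where
  aemeasurable : AEMeasurable X P
  special_subset : ∀ᵐ ω ∂P, (X ω).2 ⊆ (X ω).1.verts
  root_special : ∀ᵐ ω ∂P, [] ∈ (X ω).2
  offspring : ∀ n i : ℕ, i < n → P {ω | (X ω).RootOffspring n i} = sizeBiased p n * (n : ℝ≥0∞)⁻¹
  branching : ∀ n i : ℕ, i < n → P {ω | (X ω).RootOffspring n i} ≠ 0 →
    iIndepFun (fun (j : Fin n) (ω : Ω) => (X ω).subtree [(j : ℕ)])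
        (P[|{ω | (X ω).RootOffspring n i}]) ∧
      ∀ j : Fin n,
        ((j : ℕ) = i → IdentDistrib (fun ω => (X ω).subtree [(j : ℕ)]) X
          (P[|{ω | (X ω).RootOffspring n i}]) P) ∧
        ((j : ℕ) ≠ i → IsNormalTypedTree p (fun ω => (X ω).subtree [(j : ℕ)])
          (P[|{ω | (X ω).RootOffspring n i}]))

/-- Under `P`, `τ` is a Kesten's tree associated to `p`: for some choice of a random set of special
individuals, it is the two-type Galton–Watson tree started from a special individual. -/
def IsKestenTree {Ω : Type*} [MeasurableSpace Ω] (p : PMF ℕ) (τ : Ω → PlaneTree)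
    (P : Measure Ω) : Prop :=
  ∃ s : Ω → Set (List ℕ), IsSpecialTypedTree p (fun ω => (τ ω, s ω)) P

/-!
Both conditionings are on an event `|τ| ∈ J n`, up to a null set, where `J n` is a set of integers
that are at least `n`: a critical tree is finite almost surely (`measure_size_eq_top`).  Weak
convergence for the local metric reduces to the convergence of the probability of the set of trees
which agree with a given tree `t` up to height `h`
(`PlaneTree.le_liminf_measure_of_tendsto_heightCylinder`).

Let `w` be the product of the offspring probabilities of the `m` vertices of `t` at height less than
`h`, and let `z` be the number of its vertices at height `h`.  By the branching property, `τ` agrees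
with `t` up to height `h` and has `N` vertices with probability `w` times the probability that `z`
independent copies of `τ` have `N - m` vertices in total (`sizeSeries_heightCylinder`), whereas
Kesten's tree agrees with `t` up to height `h` with probability `z w`
(`IsSpecialTypedTree.measureReal_heightCylinder`).  It remains to show that the total size of `z`
trees is `N - m` with a probability equivalent to `z` times the probability that one tree has `N`
vertices (`IsProgenySeries.eventually_abs_coeff_pow_sub_le`).

Let `φ` be the generating series of the offspring law, so that the coefficient of `X ^ s` in `φ ^ n`
is the probability that the random walk with this step law is at `s` at time `n`.  The Otter–Dwass
formula (`IsProgenySeries.otter_dwass`) states that a forest of `k` trees has `n` vertices with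
probability `k / n` times the probability that the walk is at `n - k` at time `n`.  The claim thus
follows from the strong ratio limit theorem (`IsCriticalSeries.tendsto_walkProb_add`): for points
near the mean, and in the residue class allowed by the period, a fixed displacement in time and
space does not change these probabilities asymptotically.

The ratio theorem is proved as follows.  Conditionally on the walk being at `s` at time `n`, the
mean number of steps equal to `v` is `n` times the probability of the step `v` times the ratio of
the probabilities at `(n - 1, s - v)` and at `(n, s)`.  The number of such steps is binomial before
conditioning, and the conditioning event is not exponentially small
(`IsCriticalSeries.eventually_exp_le_coeff_pow`), because the mean of the steps is `1`; Jensen's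
inequality then forces the ratio to converge to `1`.  The displacements without asymptotic effect
form a group, and those of one step generate all the displacements allowed by the period.
-/

/-! ### Powers of power series with nonnegative coefficients -/

namespace PowerSeries

theorem coeff_mul_nonneg {f g : PowerSeries ℝ} (hf : ∀ j, 0 ≤ coeff j f)
    (hg : ∀ j, 0 ≤ coeff j g) (j : ℕ) : 0 ≤ coeff j (f * g) := by
  rw [coeff_mul]
  exact Finset.sum_nonneg fun x _ => mul_nonneg (hf _) (hg _)

theorem coeff_pow_nonneg {f : PowerSeries ℝ} (hf : ∀ j, 0 ≤ coeff j f) (n j : ℕ) :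
    0 ≤ coeff j (f ^ n) := by
  induction n generalizing j with
  | zero => rw [pow_zero, coeff_one]; split_ifs <;> norm_num
  | succ n ih => rw [pow_succ]; exact coeff_mul_nonneg ih hf j

theorem coeff_mul_coeff_le {f g : PowerSeries ℝ} (hf : ∀ j, 0 ≤ coeff j f)
    (hg : ∀ j, 0 ≤ coeff j g) (i j : ℕ) : coeff i f * coeff j g ≤ coeff (i + j) (f * g) := by
  rw [coeff_mul]
  exact Finset.single_le_sum (f := fun x : ℕ × ℕ => coeff x.1 f * coeff x.2 g)
    (fun x _ => mul_nonneg (hf _) (hg _)) (a := (i, j)) (by simp)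

theorem hasSum_coeff_mul {f g : PowerSeries ℝ} (hf : ∀ j, 0 ≤ coeff j f)
    (hg : ∀ j, 0 ≤ coeff j g) {a b : ℝ} (ha : HasSum (fun j => coeff j f) a)
    (hb : HasSum (fun j => coeff j g) b) : HasSum (fun j => coeff j (f * g)) (a * b) := by
  have hf' : Summable fun j => ‖coeff j f‖ := by
    simpa only [Real.norm_of_nonneg (hf _)] using ha.summable
  have hg' : Summable fun j => ‖coeff j g‖ := by
    simpa only [Real.norm_of_nonneg (hg _)] using hb.summable
  simp only [coeff_mul]
  rw [← ha.tsum_eq, ← hb.tsum_eq, tsum_mul_tsum_eq_tsum_sum_antidiagonal_of_summable_norm hf' hg']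
  exact (summable_norm_sum_mul_antidiagonal_of_summable_norm hf' hg').of_norm.hasSum

theorem hasSum_coeff_pow {f : PowerSeries ℝ} (hf : ∀ j, 0 ≤ coeff j f) {a : ℝ}
    (ha : HasSum (fun j => coeff j f) a) (n : ℕ) : HasSum (fun j => coeff j (f ^ n)) (a ^ n) := by
  induction n with
  | zero =>
    simp only [pow_zero, coeff_one]
    exact hasSum_ite_eq 0 1
  | succ n ih =>
    rw [pow_succ, pow_succ]
    exact hasSum_coeff_mul (coeff_pow_nonneg hf n) hf ih ha

theorem coeff_pow_le {f : PowerSeries ℝ} (hf : ∀ j, 0 ≤ coeff j f) {a : ℝ}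
    (ha : HasSum (fun j => coeff j f) a) (n j : ℕ) : coeff j (f ^ n) ≤ a ^ n :=
  le_hasSum (hasSum_coeff_pow hf ha n) j fun i _ => coeff_pow_nonneg hf n i

theorem coeff_mul_natCast (f : PowerSeries ℝ) (m j : ℕ) :
    coeff j (f * (m : PowerSeries ℝ)) = m * coeff j f := by
  rw [mul_comm, ← nsmul_eq_mul, map_nsmul, nsmul_eq_mul]

theorem coeff_X_mul_derivative (f : PowerSeries ℝ) (s : ℕ) :
    coeff s (X * d⁄dX ℝ f) = s * coeff s f := by
  cases s with
  | zero => simp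
  | succ s => rw [coeff_succ_X_mul, coeff_derivative]; push_cast; ring

/-- The exchangeability identity: in a sum of `n + 1` independent variables with value `s`, the
conditional mean of one of the variables is `s / (n + 1)`. -/
theorem coeff_pow_mul_X_mul_derivative (f : PowerSeries ℝ) (n s : ℕ) :
    (n + 1) * coeff s (f ^ n * (X * d⁄dX ℝ f)) = s * coeff s (f ^ (n + 1)) := by
  rw [← coeff_X_mul_derivative, Derivation.leibniz_pow]
  rw [Nat.add_sub_cancel, smul_eq_mul, nsmul_eq_mul, mul_comm ((n + 1 : ℕ) : PowerSeries ℝ),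
    ← mul_assoc X, coeff_mul_natCast, mul_left_comm (f ^ n)]
  push_cast
  rfl

theorem dvd_of_coeff_pow_ne_zero {f : PowerSeries ℝ} {d : ℕ}
    (hd : ∀ j, coeff j f ≠ 0 → d ∣ j) (n j : ℕ) (h : coeff j (f ^ n) ≠ 0) : d ∣ j := by
  induction n generalizing j with
  | zero =>
    rw [pow_zero, coeff_one] at h
    split_ifs at h with h0
    · simp [h0]
    · simp at h
  | succ n ih =>
    rw [pow_succ, coeff_mul] at h
    obtain ⟨x, hx, hne⟩ := Finset.exists_ne_zero_of_sum_ne_zero h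
    rw [Finset.HasAntidiagonal.mem_antidiagonal] at hx
    rw [← hx]
    exact dvd_add (ih _ (left_ne_zero_of_mul hne)) (hd _ (right_ne_zero_of_mul hne))

/-- Jensen's inequality for the number of steps of size `v` in a walk with step weights `f`,
conditioned on its position.  Writing `f = g + c X ^ v` and expanding `(g + y c X ^ v) ^ n` in `y`,
the weight of the walks with `k` steps of size `v` is multiplied by `y ^ k = e ^ (k θ)`. -/
theorem exp_mul_coeff_pow_le {f : PowerSeries ℝ} (hf : ∀ j, 0 ≤ coeff j f)
    (ha : HasSum (fun j => coeff j f) 1) (v n s : ℕ) (θ R : ℝ)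
    (hR : coeff (s + v) (f ^ (n + 1)) * R = coeff s (f ^ n)) :
    Real.exp ((n + 1) * (coeff v f * R * θ)) * coeff (s + v) (f ^ (n + 1)) ≤
      Real.exp ((n + 1) * (coeff v f * (Real.exp θ - 1))) := by
  set c := coeff v f with hc
  set M : PowerSeries ℝ := monomial v c with hM
  set g : PowerSeries ℝ := f - M with hg
  have hfg : f = M + g := by rw [hg]; ring
  have hM0 : ∀ j, 0 ≤ coeff j M := fun j => by
    rw [hM, coeff_monomial]; split_ifs
    · exact hf v
    · rfl
  have hg0 : ∀ j, 0 ≤ coeff j g := fun j => by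
    rw [hg, map_sub, hM, coeff_monomial]
    split_ifs with h
    · rw [h, hc, sub_self]
    · simpa using hf j
  set T : ℕ → ℝ := fun k => (n + 1).choose k * coeff (s + v) (M ^ k * g ^ (n + 1 - k)) with hT
  have hT0 : ∀ k, 0 ≤ T k := fun k => mul_nonneg (Nat.cast_nonneg _)
    (coeff_mul_nonneg (coeff_pow_nonneg hM0 _) (coeff_pow_nonneg hg0 _) _)
  have hy : ∀ y : ℝ, coeff (s + v) ((y • M + g) ^ (n + 1)) =
      ∑ k ∈ Finset.range (n + 2), y ^ k * T k := fun y => by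
    rw [add_pow, map_sum]
    refine Finset.sum_congr rfl fun k _ => ?_
    rw [smul_pow, smul_mul_assoc, smul_mul_assoc, coeff_smul, coeff_mul_natCast, smul_eq_mul]
  have h1 : ∑ k ∈ Finset.range (n + 2), T k = coeff (s + v) (f ^ (n + 1)) := by
    have := hy 1
    simp only [one_smul, one_pow, one_mul] at this
    rw [← this, hfg]
  have h2 : ∑ k ∈ Finset.range (n + 2), (k : ℝ) * T k = (n + 1) * (c * coeff s (f ^ n)) := by
    have e : c * coeff s (f ^ n) = coeff (s + v) (M * f ^ n) := by
      rw [hM, coeff_mul, Finset.sum_eq_single (v, s)]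
      · simp
      · rintro ⟨a, b⟩ hab hne
        rw [Finset.HasAntidiagonal.mem_antidiagonal] at hab
        rw [coeff_monomial, if_neg, zero_mul]
        rintro rfl
        exact hne (Prod.ext rfl (by simp at hab ⊢; omega))
      · intro h
        simp [add_comm] at h
    rw [e, Finset.sum_range_succ', hfg, add_pow, Finset.mul_sum, map_sum, Finset.mul_sum]
    simp only [Nat.cast_zero, zero_mul, add_zero]
    refine Finset.sum_congr rfl fun k _ => ?_
    have hch : ((n : ℝ) + 1) * n.choose k = (n + 1).choose (k + 1) * (k + 1) := by
      exact_mod_cast Nat.add_one_mul_choose_eq n k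
    rw [hT]
    simp only
    rw [← mul_assoc M, ← mul_assoc M, ← pow_succ', coeff_mul_natCast,
      ← mul_assoc ((n : ℝ) + 1), hch, Nat.add_sub_add_right]
    push_cast
    ring
  have h3 : coeff (s + v) ((Real.exp θ • M + g) ^ (n + 1)) ≤
      Real.exp ((n + 1) * (c * (Real.exp θ - 1))) := by
    have hsum : HasSum (fun j => coeff j (Real.exp θ • M + g)) (1 + c * (Real.exp θ - 1)) := by
      have := ha.add (hasSum_ite_eq v (c * (Real.exp θ - 1)))
      convert this using 2 with j
      rw [hg, hM, map_add, coeff_smul, map_sub, coeff_monomial]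
      split_ifs
      · rw [smul_eq_mul]; ring
      · simp
    have h0 : ∀ j, 0 ≤ coeff j (Real.exp θ • M + g) := fun j => by
      rw [map_add, coeff_smul]
      exact add_nonneg (mul_nonneg (Real.exp_pos _).le (hM0 j)) (hg0 j)
    refine (coeff_pow_le h0 hsum (n + 1) _).trans ?_
    have : ((n : ℝ) + 1) = ((n + 1 : ℕ) : ℝ) := by push_cast; rfl
    rw [this, Real.exp_nat_mul]
    refine pow_le_pow_left₀ (hsum.nonneg h0) ?_ _
    linarith [Real.add_one_le_exp (c * (Real.exp θ - 1))]
  refine le_trans ?_ h3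
  rw [hy]
  set μ : ℝ := (n + 1) * (c * R) with hμ
  have h4 : ∀ k ∈ Finset.range (n + 2),
      Real.exp (μ * θ) * ((1 - μ * θ) * T k + θ * (k * T k)) ≤ Real.exp θ ^ k * T k := by
    intro k _
    rw [← Real.exp_nat_mul]
    have : Real.exp (μ * θ) * (1 + (k - μ) * θ) ≤ Real.exp (k * θ) := by
      have e : (k : ℝ) * θ = μ * θ + (k - μ) * θ := by ring
      rw [e, Real.exp_add]
      gcongr
      linarith [Real.add_one_le_exp ((k - μ) * θ)]
    calc _ = Real.exp (μ * θ) * (1 + (k - μ) * θ) * T k := by ring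
      _ ≤ _ := mul_le_mul_of_nonneg_right this (hT0 k)
  refine le_trans (le_of_eq ?_) (Finset.sum_le_sum h4)
  rw [← Finset.mul_sum, Finset.sum_add_distrib, ← Finset.mul_sum, ← Finset.mul_sum, h1, h2, ← hR,
    hμ]
  rw [show ((n : ℝ) + 1) * (c * R) * θ = (n + 1) * (c * R * θ) by ring]
  ring

end PowerSeries

/-! ### Deviations of a critical random walk -/

/-- The generating series of a critical, non-degenerate offspring law: the coefficients are the
weights of a probability distribution on `ℕ` of mean `1` which charges `0` and some `v ≥ 2`. The
coefficient of `X ^ s` in the `n`-th power is the probability that the associated random walk is at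
`s` at time `n`. -/
structure IsCriticalSeries (φ : PowerSeries ℝ) : Prop where
  nonneg : ∀ j, 0 ≤ PowerSeries.coeff j φ
  hasSum_one : HasSum (fun j => PowerSeries.coeff j φ) 1
  hasSum_mean : HasSum (fun j : ℕ => (j : ℝ) * PowerSeries.coeff j φ) 1
  coeff_zero_pos : 0 < PowerSeries.coeff 0 φ
  exists_two_le : ∃ v, 2 ≤ v ∧ 0 < PowerSeries.coeff v φ

namespace IsCriticalSeries

open PowerSeries

variable {φ : PowerSeries ℝ}

theorem hasSum_mean_pow (hφ : IsCriticalSeries φ) (n : ℕ) :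
    HasSum (fun s : ℕ => (s : ℝ) * coeff s (φ ^ n)) n := by
  cases n with
  | zero =>
    have : (fun s : ℕ => (s : ℝ) * coeff s (φ ^ 0)) = fun _ => 0 := by
      ext s
      rw [pow_zero, coeff_one]
      split_ifs with h <;> simp [h]
    rw [this, Nat.cast_zero]
    exact hasSum_zero
  | succ n =>
    have h1 : ∀ j, 0 ≤ coeff j (X * d⁄dX ℝ φ) := fun j => by
      rw [coeff_X_mul_derivative]
      exact mul_nonneg (Nat.cast_nonneg _) (hφ.nonneg j)
    have h2 : HasSum (fun j => coeff j (X * d⁄dX ℝ φ)) 1 := by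
      simpa only [coeff_X_mul_derivative] using hφ.hasSum_mean
    have := (hasSum_coeff_mul (coeff_pow_nonneg hφ.nonneg n) h1
      (hasSum_coeff_pow hφ.nonneg hφ.hasSum_one n) h2).mul_left ((n : ℝ) + 1)
    simpa only [coeff_pow_mul_X_mul_derivative, one_pow, mul_one, Nat.cast_succ] using this

/-- The Laplace transform of a law of mean `1` at a small `θ > 0` is less than
`exp (-(1 - δ) θ)`. -/
theorem exists_laplace_le (hφ : IsCriticalSeries φ) {δ : ℝ} (hδ : 0 < δ) :
    ∃ θ > 0, ∃ η < 0, ∃ a, HasSum (fun j => coeff j (rescale (Real.exp (-θ)) φ)) a ∧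
      a * Real.exp (θ * (1 - δ)) ≤ Real.exp η := by
  have ev : ∀ᶠ s : Finset ℕ in atTop, 1 - δ / 2 < ∑ j ∈ s, (j : ℝ) * coeff j φ :=
    hφ.hasSum_mean.eventually (lt_mem_nhds (by linarith))
  obtain ⟨s, hs⟩ := ev.exists
  obtain ⟨K, hK⟩ := s.exists_nat_subset_range
  have hK1 : 1 - δ / 2 ≤ ∑ j ∈ Finset.range K, (j : ℝ) * coeff j φ :=
    hs.le.trans (Finset.sum_le_sum_of_subset_of_nonneg hK fun j _ _ =>
      mul_nonneg (Nat.cast_nonneg _) (hφ.nonneg j))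
  set L : ℝ := (K : ℝ) + 1 with hL
  have hLpos : 0 < L := by positivity
  obtain ⟨θ, hθ, hθ1, hθ2⟩ : ∃ θ > 0, θ * L ≤ 1 ∧ θ * L ^ 2 < δ / 2 := by
    refine ⟨min (1 / L) (δ / (4 * L ^ 2)), by positivity, ?_, ?_⟩
    · calc _ ≤ 1 / L * L := by gcongr; exact min_le_left _ _
        _ = 1 := by field_simp
    · calc _ ≤ δ / (4 * L ^ 2) * L ^ 2 := by gcongr; exact min_le_right _ _
        _ = δ / 4 := by field_simp
        _ < δ / 2 := by linarith
  have hx1 : Real.exp (-θ) ≤ 1 := Real.exp_le_one_iff.2 (by linarith)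
  have hco : ∀ j, coeff j (rescale (Real.exp (-θ)) φ) = Real.exp (-(θ * j)) * coeff j φ := by
    intro j
    rw [coeff_rescale, ← Real.exp_nat_mul]
    congr 2
    ring
  have hle : ∀ j, coeff j (rescale (Real.exp (-θ)) φ) ≤ coeff j φ := fun j => by
    rw [hco]
    exact mul_le_of_le_one_left (hφ.nonneg j) (Real.exp_le_one_iff.2 (by
      have : 0 ≤ θ * j := by positivity
      linarith))
  have hsummable : Summable fun j => coeff j (rescale (Real.exp (-θ)) φ) :=
    Summable.of_nonneg_of_le (fun j => by
      rw [hco]; exact mul_nonneg (Real.exp_pos _).le (hφ.nonneg j)) hle hφ.hasSum_one.summable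
  refine ⟨θ, hθ, θ * (θ * L ^ 2 - δ / 2), mul_neg_of_pos_of_neg hθ (by linarith), _,
    hsummable.hasSum, ?_⟩
  -- the terms of index at least `K` are bounded by `coeff j φ`, the others by a Taylor expansion
  have hb : HasSum (fun j : ℕ => coeff j φ + if j ∈ Finset.range K then
      (-θ * (j * coeff j φ) + θ ^ 2 * L ^ 2 * coeff j φ) else 0)
      (1 + ∑ j ∈ Finset.range K, (-θ * (j * coeff j φ) + θ ^ 2 * L ^ 2 * coeff j φ)) := by
    refine hφ.hasSum_one.add ?_
    have := hasSum_sum_of_ne_finset_zero (s := Finset.range K) (f := fun j : ℕ =>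
      if j ∈ Finset.range K then
      (-θ * (j * coeff j φ) + θ ^ 2 * L ^ 2 * coeff j φ) else 0) (fun j hj => if_neg hj)
      (L := SummationFilter.unconditional ℕ)
    rwa [Finset.sum_congr rfl fun j hj => if_pos hj] at this
  have hA := hasSum_le (fun j => ?_) hsummable.hasSum hb
  · have hs1 : ∑ j ∈ Finset.range K, coeff j φ ≤ 1 :=
      sum_le_hasSum _ (fun j _ => hφ.nonneg j) hφ.hasSum_one
    rw [Finset.sum_add_distrib, ← Finset.mul_sum, ← Finset.mul_sum] at hA
    have h1 : -θ * ∑ j ∈ Finset.range K, (j : ℝ) * coeff j φ ≤ -θ * (1 - δ / 2) :=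
      mul_le_mul_of_nonpos_left hK1 (by linarith)
    have h2 : θ ^ 2 * L ^ 2 * ∑ j ∈ Finset.range K, coeff j φ ≤ θ ^ 2 * L ^ 2 :=
      mul_le_of_le_one_right (by positivity) hs1
    have h3 : ∑' j, coeff j (rescale (Real.exp (-θ)) φ) ≤
        Real.exp (-θ * (1 - δ / 2) + θ ^ 2 * L ^ 2) := by
      linarith [Real.add_one_le_exp (-θ * (1 - δ / 2) + θ ^ 2 * L ^ 2)]
    refine (mul_le_mul_of_nonneg_right h3 (Real.exp_pos _).le).trans ?_
    rw [← Real.exp_add]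
    apply Real.exp_le_exp.2
    linarith
  · split_ifs with hj
    · rw [hco]
      have hjK : (j : ℝ) ≤ L := by
        have : (j : ℝ) < K := by exact_mod_cast Finset.mem_range.1 hj
        linarith
      have hb1 : θ * j ≤ 1 := (mul_le_mul_of_nonneg_left hjK hθ.le).trans hθ1
      have hb0 : 0 ≤ θ * j := by positivity
      have h := (abs_le.1 (Real.abs_exp_sub_one_sub_id_le (x := -(θ * j))
        (by rw [abs_neg, abs_of_nonneg hb0]; exact hb1))).2
      have h' : (-(θ * j)) ^ 2 ≤ θ ^ 2 * L ^ 2 := by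
        rw [neg_sq, mul_pow]
        gcongr
      have h'' : Real.exp (-(θ * j)) ≤ 1 - θ * j + θ ^ 2 * L ^ 2 := by linarith
      calc _ ≤ (1 - θ * j + θ ^ 2 * L ^ 2) * coeff j φ :=
          mul_le_mul_of_nonneg_right h'' (hφ.nonneg j)
        _ = _ := by ring
    · rw [add_zero]
      exact hle j

/-- The walk at a large time `n` is within `δ n` of its mean with a probability that is not
exponentially small: the lower deviation is excluded by a Chernoff bound, and for the upper
deviation Markov's inequality is enough, since it leaves a mass `δ / (1 + δ)`. -/
theorem exists_le_coeff_pow (hφ : IsCriticalSeries φ) {δ : ℝ} (hδ : 0 < δ) (hδ1 : δ ≤ 1) :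
    ∀ᶠ n : ℕ in atTop, ∃ s : ℕ, (1 - δ) * n ≤ s ∧ s ≤ (1 + δ) * n ∧
      δ / (4 * (2 * n + 1)) ≤ coeff s (φ ^ n) := by
  obtain ⟨θ, hθ, η, hη, a, ha, haη⟩ := hφ.exists_laplace_le hδ
  have hlim : Tendsto (fun n : ℕ => Real.exp η ^ n) atTop (𝓝 0) :=
    tendsto_pow_atTop_nhds_zero_of_lt_one (Real.exp_pos _).le (Real.exp_lt_one_iff.2 hη)
  filter_upwards [hlim.eventually (gt_mem_nhds (show (0 : ℝ) < δ / 4 by linarith)),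
    eventually_ge_atTop 1] with n hn hn1
  have hnpos : (0 : ℝ) < n := by exact_mod_cast hn1
  -- otherwise the total mass `1` is at most the sum of a Chernoff bound for the positions below the
  -- window, a Markov bound for those above it, and at most `δ / 4` for the window itself
  by_contra! hcon
  have hx0 : ∀ j, 0 ≤ coeff j (rescale (Real.exp (-θ)) φ) := fun j => by
    rw [coeff_rescale]
    exact mul_nonneg (pow_nonneg (Real.exp_pos _).le _) (hφ.nonneg j)
  have hA := hasSum_coeff_pow hx0 ha n
  have hA' := hA.mul_left (Real.exp (θ * (1 - δ)) ^ n)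
  have hM := (hφ.hasSum_mean_pow n).mul_left (1 / ((1 + δ) * n))
  have hW := hasSum_sum_of_ne_finset_zero (s := Finset.range (2 * n + 1)) (f := fun j : ℕ =>
      if j ∈ Finset.range (2 * n + 1) then δ / (4 * (2 * n + 1)) else 0) (fun j hj => if_neg hj)
      (L := SummationFilter.unconditional ℕ)
  rw [Finset.sum_congr rfl fun j hj => if_pos hj, Finset.sum_const, Finset.card_range,
    nsmul_eq_mul] at hW
  have hle := hasSum_le (fun s => ?_)
    (hasSum_coeff_pow hφ.nonneg hφ.hasSum_one n) ((hA'.add hM).add hW)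
  · have e1 : Real.exp (θ * (1 - δ)) ^ n * a ^ n ≤ Real.exp η ^ n := by
      rw [← mul_pow, mul_comm]
      exact pow_le_pow_left₀ (mul_nonneg (ha.nonneg hx0) (Real.exp_pos _).le) haη n
    have e2 : 1 / ((1 + δ) * n) * n = 1 / (1 + δ) := by field_simp
    have e3 : ((2 * n + 1 : ℕ) : ℝ) * (δ / (4 * (2 * n + 1))) = δ / 4 := by
      push_cast
      field_simp
    rw [e2, e3, one_pow] at hle
    have e4 : 1 / (1 + δ) ≤ 1 - δ / 2 := by
      rw [div_le_iff₀ (by linarith)]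
      nlinarith
    linarith
  · have c0 := coeff_pow_nonneg hφ.nonneg n s
    have t1 : 0 ≤ Real.exp (θ * (1 - δ)) ^ n * coeff s (rescale (Real.exp (-θ)) φ ^ n) :=
      mul_nonneg (pow_nonneg (Real.exp_pos _).le _) (coeff_pow_nonneg hx0 n s)
    have t2 : 0 ≤ 1 / ((1 + δ) * n) * (s * coeff s (φ ^ n)) := by positivity
    have t3 : 0 ≤ if s ∈ Finset.range (2 * n + 1) then δ / (4 * (2 * (n : ℝ) + 1)) else 0 := by
      split_ifs <;> positivity
    by_cases hs1 : (1 - δ) * n ≤ s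
    · by_cases hs2 : s ≤ (1 + δ) * n
      · have := hcon s hs1 hs2
        have hmem : s ∈ Finset.range (2 * n + 1) := by
          rw [Finset.mem_range, Nat.lt_succ_iff]
          have : (s : ℝ) ≤ 2 * n := hs2.trans (by gcongr; linarith)
          exact_mod_cast this
        rw [if_pos hmem]
        linarith
      · have : coeff s (φ ^ n) ≤ 1 / ((1 + δ) * n) * (s * coeff s (φ ^ n)) := by
          rw [← mul_assoc]
          refine le_mul_of_one_le_left c0 ?_
          rw [one_div, inv_mul_eq_div, one_le_div (by positivity)]
          exact (not_le.1 hs2).le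
        linarith
    · have : coeff s (φ ^ n) ≤
          Real.exp (θ * (1 - δ)) ^ n * coeff s (rescale (Real.exp (-θ)) φ ^ n) := by
        rw [← map_pow, coeff_rescale, ← mul_assoc, ← Real.exp_nat_mul, ← Real.exp_nat_mul,
          ← Real.exp_add]
        refine le_mul_of_one_le_left c0 (Real.one_le_exp ?_)
        have := (not_le.1 hs1).le
        nlinarith
      linarith

end IsCriticalSeries

/-! ### Probabilities which are not exponentially small -/

namespace PowerSeries

variable {φ : PowerSeries ℝ}

/-- The period of a series: the greatest common divisor of the exponents which occur in it. -/
noncomputable def period (φ : PowerSeries ℝ) : ℕ :=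
  Nat.setGcd {j | coeff j φ ≠ 0}

theorem period_dvd_of_coeff_pow_ne_zero {n j : ℕ} (h : coeff j (φ ^ n) ≠ 0) :
    φ.period ∣ j :=
  dvd_of_coeff_pow_ne_zero (fun _ hj => Nat.setGcd_dvd_of_mem hj) n j h

end PowerSeries

namespace IsCriticalSeries

open PowerSeries

variable {φ : PowerSeries ℝ}

theorem coeff_pow_mul_le (hφ : IsCriticalSeries φ) (m n i j : ℕ) :
    coeff i (φ ^ m) * coeff j (φ ^ n) ≤ coeff (i + j) (φ ^ (m + n)) := by
  rw [pow_add]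
  exact coeff_mul_coeff_le (coeff_pow_nonneg hφ.nonneg m) (coeff_pow_nonneg hφ.nonneg n) i j

theorem pow_le_coeff_pow (hφ : IsCriticalSeries φ) (v n : ℕ) :
    coeff v φ ^ n ≤ coeff (v * n) (φ ^ n) := by
  induction n with
  | zero => simp
  | succ n ih =>
    rw [pow_succ, pow_succ, mul_add, mul_one]
    exact (mul_le_mul_of_nonneg_right ih (hφ.nonneg v)).trans
      (coeff_mul_coeff_le (coeff_pow_nonneg hφ.nonneg n) hφ.nonneg _ _)

theorem eventually_coeff_pow_pos (hφ : IsCriticalSeries φ) {r : ℕ}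
    (hr : r ∈ AddSubmonoid.closure {j | coeff j φ ≠ 0}) :
    ∀ᶠ n : ℕ in atTop, 0 < coeff r (φ ^ n) := by
  obtain ⟨m, hm⟩ : ∃ m, 0 < coeff r (φ ^ m) := by
    induction hr using AddSubmonoid.closure_induction with
    | mem x hx => exact ⟨1, by rw [pow_one]; exact (hφ.nonneg x).lt_of_ne' hx⟩
    | zero => exact ⟨0, by simp⟩
    | add x y _ _ hx hy =>
      obtain ⟨m, hm⟩ := hx
      obtain ⟨n, hn⟩ := hy
      exact ⟨m + n, (mul_pos hm hn).trans_le (hφ.coeff_pow_mul_le m n x y)⟩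
  filter_upwards [eventually_ge_atTop m] with n hn
  obtain ⟨i, rfl⟩ := Nat.exists_eq_add_of_le hn
  have h1 := hφ.coeff_pow_mul_le m i r 0
  have h2 := hφ.pow_le_coeff_pow 0 i
  rw [zero_mul] at h2
  exact (mul_pos hm ((pow_pos hφ.coeff_zero_pos i).trans_le h2)).trans_le h1

/-- The walk can reach, in `m` steps, any large multiple `r` of the period with `r ≤ 2 m - 2 K`, at
an exponential cost only.  Most of the displacement is done by steps of a fixed size `v ≥ 2`. -/
theorem exists_exp_le_coeff_pow (hφ : IsCriticalSeries φ) :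
    ∃ c : ℝ, 0 ≤ c ∧ ∃ K : ℕ, ∀ m r : ℕ, φ.period ∣ r → K ≤ r → r + 2 * K ≤ 2 * m →
      Real.exp (-(c * m)) ≤ coeff r (φ ^ m) := by
  obtain ⟨v, hv2, hv⟩ := hφ.exists_two_le
  obtain ⟨N, hN⟩ := Nat.exists_mem_closure_of_ge {j | coeff j φ ≠ 0}
  have hdv : φ.period ∣ v := Nat.setGcd_dvd_of_mem hv.ne'
  -- the displacements less than `N + v` to which `r` is reduced modulo `v` take a fixed number of
  -- steps `M`, since steps of size `0` are allowed
  have hM : ∀ᶠ M : ℕ in atTop, ∀ r ∈ Finset.range (N + v), N ≤ r → φ.period ∣ r →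
      0 < coeff r (φ ^ M) := by
    rw [eventually_all_finset]
    intro r _
    by_cases h : N ≤ r ∧ φ.period ∣ r
    · exact (hφ.eventually_coeff_pow_pos (hN r h.1 h.2)).mono fun _ h _ _ => h
    · exact Eventually.of_forall fun _ h1 h2 => absurd ⟨h1, h2⟩ h
  obtain ⟨M, hM, hM1⟩ := (hM.and (eventually_ge_atTop 1)).exists
  have hε : ∀ᶠ ε : ℝ in 𝓝[>] 0, ∀ r ∈ Finset.range (N + v), N ≤ r → φ.period ∣ r →
      ε ≤ coeff r (φ ^ M) := by
    rw [eventually_all_finset]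
    intro r hr
    by_cases h : N ≤ r ∧ φ.period ∣ r
    · filter_upwards [Ioc_mem_nhdsGT (hM r hr h.1 h.2)] with ε hε _ _ using hε.2
    · exact Eventually.of_forall fun _ h1 h2 => absurd ⟨h1, h2⟩ h
  have hε2 : ∀ᶠ ε : ℝ in 𝓝[>] 0, ε ∈ Set.Ioc 0 (min 1 (min (coeff v φ) (coeff 0 φ))) :=
    Ioc_mem_nhdsGT (lt_min one_pos (lt_min hv hφ.coeff_zero_pos))
  obtain ⟨ε, hε, hε0, hεle⟩ := (hε.and hε2).exists
  have hε1 : ε ≤ 1 := hεle.trans (min_le_left _ _)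
  have hεv : ε ≤ coeff v φ := hεle.trans ((min_le_right _ _).trans (min_le_left _ _))
  have hεz : ε ≤ coeff 0 φ := hεle.trans ((min_le_right _ _).trans (min_le_right _ _))
  refine ⟨-Real.log ε, by linarith [Real.log_nonpos hε0.le hε1], N + M, fun m r hr hKr hrm => ?_⟩
  have e : Real.exp (-(-Real.log ε * m)) = ε ^ m := by
    rw [neg_mul, neg_neg, mul_comm, Real.exp_nat_mul, Real.exp_log hε0]
  rw [e]
  set j := (r - N) / v with hj
  set r₀ := N + (r - N) % v with hr₀
  have hvpos : 0 < v := by omega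
  have hrj : r = r₀ + v * j := by
    have := Nat.mod_add_div (r - N) v
    rw [← hj] at this
    omega
  have hr₀v : r₀ < N + v := by
    have := Nat.mod_lt (r - N) hvpos
    omega
  have hr₀d : φ.period ∣ r₀ := by
    rw [hrj] at hr
    exact (Nat.dvd_add_left (hdv.mul_right j)).1 hr
  have hjr : 2 * j ≤ r := by
    have : 2 * j ≤ v * j := Nat.mul_le_mul_right j hv2
    omega
  obtain ⟨i, hi⟩ : ∃ i, m = M + j + i := Nat.exists_eq_add_of_le (by omega)
  have h1 : ε ≤ coeff r₀ (φ ^ M) := hε r₀ (Finset.mem_range.2 hr₀v) (by omega) hr₀d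
  have h2 : ε ^ j ≤ coeff (v * j) (φ ^ j) :=
    (pow_le_pow_left₀ hε0.le hεv j).trans (hφ.pow_le_coeff_pow v j)
  have h3 : ε ^ i ≤ coeff (0 * i) (φ ^ i) :=
    (pow_le_pow_left₀ hε0.le hεz i).trans (hφ.pow_le_coeff_pow 0 i)
  rw [zero_mul] at h3
  have h4 := coeff_pow_nonneg hφ.nonneg M r₀
  have h5 := coeff_pow_nonneg hφ.nonneg j (v * j)
  calc ε ^ m ≤ ε ^ (1 + j + i) := pow_le_pow_of_le_one hε0.le hε1 (by omega)
    _ = ε * ε ^ j * ε ^ i := by ring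
    _ ≤ coeff r₀ (φ ^ M) * coeff (v * j) (φ ^ j) * coeff 0 (φ ^ i) :=
      mul_le_mul (mul_le_mul h1 h2 (pow_nonneg hε0.le _) h4) h3 (pow_nonneg hε0.le _)
        (mul_nonneg h4 h5)
    _ ≤ coeff (r₀ + v * j) (φ ^ (M + j)) * coeff 0 (φ ^ i) :=
      mul_le_mul_of_nonneg_right (hφ.coeff_pow_mul_le _ _ _ _) (coeff_pow_nonneg hφ.nonneg _ _)
    _ ≤ coeff (r₀ + v * j + 0) (φ ^ (M + j + i)) := hφ.coeff_pow_mul_le _ _ _ _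
    _ = coeff r (φ ^ m) := by rw [← hi, add_zero, ← hrj]

/-- The probability that the walk is, at time `n`, at a point of the right residue class at bounded
distance from its mean is not exponentially small.  The walk runs freely for most of the time, which
brings it within `δ n` of its mean, and a number of steps of order `δ n` corrects its position. -/
theorem eventually_exp_le_coeff_pow (hφ : IsCriticalSeries φ) {κ : ℝ} (hκ : 0 < κ) (b : ℤ) :
    ∀ᶠ n : ℕ in atTop, ∀ s : ℕ, (s : ℤ) = n + b → φ.period ∣ s →
      Real.exp (-(κ * n)) ≤ coeff s (φ ^ n) := by
  obtain ⟨c, hc, K, hcK⟩ := hφ.exists_exp_le_coeff_pow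
  obtain ⟨δ, hδ, hδ4, hδκ⟩ : ∃ δ > 0, δ ≤ 1 / 4 ∧ 2 * c * δ ≤ κ / 2 := by
    refine ⟨min (1 / 4) (κ / (4 * (c + 1))), by positivity, min_le_left _ _, ?_⟩
    calc _ ≤ 2 * (c + 1) * (κ / (4 * (c + 1))) := by
          gcongr
          · linarith
          · exact min_le_right _ _
      _ = κ / 2 := by field_simp; norm_num
  obtain ⟨n₀, hn₀⟩ := eventually_atTop.1 (hφ.exists_le_coeff_pow hδ (by linarith))
  have hr1 : Real.exp (-(κ / 2)) < 1 := Real.exp_lt_one_iff.2 (by linarith)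
  have hlim : Tendsto (fun n : ℕ => (2 * (n : ℝ) + 1) * Real.exp (-(κ / 2)) ^ n) atTop (𝓝 0) := by
    have h1 := tendsto_self_mul_const_pow_of_lt_one (Real.exp_pos (-(κ / 2))).le hr1
    have h2 := tendsto_pow_atTop_nhds_zero_of_lt_one (Real.exp_pos (-(κ / 2))).le hr1
    have := (h1.const_mul 2).add h2
    rw [mul_zero, add_zero] at this
    exact this.congr fun n => by ring
  have hbig : ∀ᶠ n : ℕ in atTop, |(b : ℝ)| + 2 * K ≤ δ * n :=
    (tendsto_natCast_atTop_atTop.const_mul_atTop hδ).eventually_ge_atTop _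
  have hpos : (0 : ℝ) < δ / 4 * Real.exp (-c) := by positivity
  filter_upwards [hlim.eventually (gt_mem_nhds hpos), hbig,
    eventually_ge_atTop (2 * n₀ + 4)] with N hN hNb hNn s hs hds
  -- the last `m` steps have to make up for a displacement between `δ N + b` and `m + δ N + b`
  set m := ⌈2 * δ * N⌉₊ with hm
  have hN0 : (0 : ℝ) ≤ N := Nat.cast_nonneg N
  have hN4 : (4 : ℝ) ≤ N := by exact_mod_cast (by omega : 4 ≤ N)
  have hm1 : 2 * δ * N ≤ m := Nat.le_ceil _
  have hm2 : (m : ℝ) < 2 * δ * N + 1 := Nat.ceil_lt_add_one (by positivity)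
  have hm3 : (m : ℝ) ≤ N / 2 + 1 := by nlinarith
  have hmN : 2 * m ≤ N + 2 := by
    have : (2 * m : ℝ) ≤ N + 2 := by linarith
    exact_mod_cast this
  obtain ⟨n, hn⟩ : ∃ n, N = n + m := ⟨N - m, by omega⟩
  obtain ⟨s', hs1, hs2, hs3⟩ := hn₀ n (by omega)
  have hnN : (N : ℝ) = n + m := by exact_mod_cast hn
  have hs' : (s : ℝ) = N + b := by exact_mod_cast hs
  have hb1 := neg_abs_le (b : ℝ)
  have hb2 := le_abs_self (b : ℝ)
  have hK0 : (0 : ℝ) ≤ K := Nat.cast_nonneg K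
  have hlow : (s' : ℝ) + K ≤ s := by
    rw [hs']
    have : δ * m ≥ 0 := by positivity
    have e : (1 + δ) * n = N + δ * N - m - δ * m := by rw [hnN]; ring
    linarith
  have hdvd : φ.period ∣ s' := by
    apply period_dvd_of_coeff_pow_ne_zero (n := n)
    have : 0 < δ / (4 * (2 * (n : ℝ) + 1)) := by positivity
    linarith
  obtain ⟨r, hr⟩ : ∃ r, s = s' + r :=
    Nat.exists_eq_add_of_le (by have : (s' : ℝ) ≤ s := by linarith
                                exact_mod_cast this)
  have hrr : (s : ℝ) = s' + r := by exact_mod_cast hr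
  have hKr : K ≤ r := by
    have : (K : ℝ) ≤ r := by linarith
    exact_mod_cast this
  have hrm : r + 2 * K ≤ 2 * m := by
    have : (r : ℝ) + 2 * K ≤ 2 * m := by
      have : δ * m ≥ 0 := by positivity
      have e : (1 - δ) * n = N - δ * N - m + δ * m := by rw [hnN]; ring
      linarith
    exact_mod_cast this
  have hdr : φ.period ∣ r := by
    rw [hr] at hds
    exact (Nat.dvd_add_right hdvd).1 hds
  have hstep := hcK m r hdr hKr hrm
  have hmul := hφ.coeff_pow_mul_le n m s' r
  rw [← hn, ← hr] at hmul
  refine le_trans ?_ hmul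
  refine le_trans ?_ (mul_le_mul hs3 hstep (Real.exp_pos _).le (coeff_pow_nonneg hφ.nonneg _ _))
  have e1 : Real.exp (-(κ * N)) = Real.exp (-(κ / 2)) ^ N * Real.exp (-(κ / 2 * N)) := by
    rw [← Real.exp_nat_mul, ← Real.exp_add]
    congr 1
    ring
  have e2 : Real.exp (-c) * Real.exp (-(κ / 2 * N)) ≤ Real.exp (-(c * m)) := by
    rw [← Real.exp_add]
    apply Real.exp_le_exp.2
    have h1 : c * m ≤ c * (2 * δ * N + 1) := mul_le_mul_of_nonneg_left hm2.le hc
    have h2 : 2 * c * δ * N ≤ κ / 2 * N := mul_le_mul_of_nonneg_right hδκ hN0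
    linarith
  have e3 : Real.exp (-(κ / 2)) ^ N ≤ δ / (4 * (2 * n + 1)) * Real.exp (-c) := by
    have hnle : (2 * (n : ℝ) + 1) ≤ 2 * N + 1 := by
      have : (0 : ℝ) ≤ m := Nat.cast_nonneg m
      linarith
    have h0 : (0 : ℝ) < 2 * n + 1 := by positivity
    have : (2 * (n : ℝ) + 1) * Real.exp (-(κ / 2)) ^ N ≤ δ / 4 * Real.exp (-c) :=
      (mul_le_mul_of_nonneg_right hnle (pow_nonneg (Real.exp_pos _).le _)).trans hN.le
    calc _ = (2 * (n : ℝ) + 1) * Real.exp (-(κ / 2)) ^ N / (2 * n + 1) := by field_simp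
      _ ≤ δ / 4 * Real.exp (-c) / (2 * n + 1) := by gcongr
      _ = _ := by field_simp
  calc _ ≤ δ / (4 * (2 * n + 1)) * Real.exp (-c) * Real.exp (-(κ / 2 * N)) := by
        rw [e1]; gcongr
    _ = δ / (4 * (2 * n + 1)) * (Real.exp (-c) * Real.exp (-(κ / 2 * N))) := by ring
    _ ≤ _ := by gcongr

end IsCriticalSeries

/-! ### The strong ratio limit theorem -/

namespace PowerSeries

variable {φ : PowerSeries ℝ}

/-- The probability that the walk is at `x.2` at time `x.1`, as a function on `ℤ × ℤ`. Only the
values at points with nonnegative coordinates matter. -/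
noncomputable def walkProb (φ : PowerSeries ℝ) (x : ℤ × ℤ) : ℝ :=
  coeff x.2.toNat (φ ^ x.1.toNat)

/-- The filter on time-space points `(n, s)` along which `n → ∞` and `s - n` stays bounded, while
`s` is a multiple of the period. -/
noncomputable def walkFilter (φ : PowerSeries ℝ) : Filter (ℤ × ℤ) :=
  ⨆ b : ℤ, Filter.map (fun n : ℕ => ((n : ℤ), (n : ℤ) + b)) (atTop ⊓ 𝓟 {n | (φ.period : ℤ) ∣ n + b})

theorem eventually_walkFilter {p : ℤ × ℤ → Prop} :
    (∀ᶠ x in φ.walkFilter, p x) ↔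
      ∀ b : ℤ, ∀ᶠ n : ℕ in atTop, (φ.period : ℤ) ∣ n + b → p ((n : ℤ), (n : ℤ) + b) := by
  simp only [walkFilter, eventually_iSup, eventually_map, eventually_inf_principal,
    Set.mem_ofPred_eq]

theorem tendsto_add_walkFilter {y : ℤ × ℤ} (hy : (φ.period : ℤ) ∣ y.2) :
    Tendsto (fun x => x + y) φ.walkFilter φ.walkFilter := by
  intro U hU
  change ∀ᶠ x in φ.walkFilter, x + y ∈ U
  have hU' : ∀ᶠ x in φ.walkFilter, x ∈ U := hU
  rw [eventually_walkFilter] at hU' ⊢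
  intro b
  have hlim : Tendsto (fun n : ℕ => ((n : ℤ) + y.1).toNat) atTop atTop :=
    tendsto_atTop.2 fun k => by
      filter_upwards [eventually_ge_atTop (k + y.1.natAbs)] with n hn
      omega
  filter_upwards [hlim.eventually (hU' (b + y.2 - y.1)), eventually_ge_atTop y.1.natAbs]
    with n hn hn1 hd
  have e : ((((n : ℤ) + y.1).toNat : ℕ) : ℤ) = n + y.1 := Int.toNat_of_nonneg (by omega)
  have e2 : (n : ℤ) + y.1 + (b + y.2 - y.1) = n + b + y.2 := by ring
  rw [e, e2] at hn
  exact hn (dvd_add hd hy)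

end PowerSeries

namespace IsCriticalSeries

open PowerSeries

variable {φ : PowerSeries ℝ}

theorem eventually_exp_le_walkProb (hφ : IsCriticalSeries φ) {κ : ℝ} (hκ : 0 < κ) :
    ∀ᶠ x in φ.walkFilter, Real.exp (-(κ * x.1)) ≤ φ.walkProb x := by
  rw [eventually_walkFilter]
  intro b
  filter_upwards [hφ.eventually_exp_le_coeff_pow hκ b, eventually_ge_atTop b.natAbs]
    with n hn hn1 hd
  obtain ⟨s, hs⟩ := Int.eq_ofNat_of_zero_le (show 0 ≤ (n : ℤ) + b by omega)
  rw [hs] at hd ⊢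
  simpa [walkProb] using hn s hs.symm (Int.natCast_dvd_natCast.1 hd)

theorem eventually_walkProb_pos (hφ : IsCriticalSeries φ) :
    ∀ᶠ x in φ.walkFilter, 0 < φ.walkProb x :=
  (hφ.eventually_exp_le_walkProb one_pos).mono fun _ hx => (Real.exp_pos _).trans_le hx

/-- The strong ratio limit theorem for the removal of one step of size `v`.  The ratio, multiplied
by `n * coeff v φ`, is the conditional mean of the number of steps of size `v`; as the conditioning
event is not exponentially small, this number cannot deviate from `n * coeff v φ`. -/
theorem tendsto_walkProb_sub_step (hφ : IsCriticalSeries φ) {v : ℕ} (hv : coeff v φ ≠ 0) :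
    Tendsto (fun x => φ.walkProb (x + (-1, -(v : ℤ))) / φ.walkProb x) φ.walkFilter (𝓝 1) := by
  have hv0 : 0 < coeff v φ := (hφ.nonneg v).lt_of_ne' hv
  rw [Metric.tendsto_nhds]
  intro ε hε
  obtain ⟨θ, hθ, hθ1, hθε⟩ : ∃ θ > 0, θ ≤ 1 ∧ 2 * θ < ε :=
    ⟨min 1 (ε / 3), by positivity, min_le_left _ _, by linarith [min_le_right 1 (ε / 3)]⟩
  have hκ : 0 < coeff v φ * θ ^ 2 := by positivity
  have hev := hφ.eventually_exp_le_walkProb hκ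
  rw [eventually_walkFilter] at hev ⊢
  intro b
  filter_upwards [hev b, eventually_ge_atTop (b.natAbs + v + 1)] with N hN hNb hd
  have hN := hN hd
  obtain ⟨n, rfl⟩ : ∃ n, N = n + 1 := ⟨N - 1, by omega⟩
  obtain ⟨s, hs⟩ := Int.eq_ofNat_of_zero_le (show 0 ≤ ((n + 1 : ℕ) : ℤ) + b - v by omega)
  have hs' : ((n + 1 : ℕ) : ℤ) + b = ((s + v : ℕ) : ℤ) := by push_cast; push_cast at hs; omega
  have e1 : φ.walkProb (((n + 1 : ℕ) : ℤ), ((n + 1 : ℕ) : ℤ) + b) =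
      coeff (s + v) (φ ^ (n + 1)) := by
    rw [hs']
    simp only [walkProb, Int.toNat_natCast]
  have e2 : φ.walkProb ((((n + 1 : ℕ) : ℤ), ((n + 1 : ℕ) : ℤ) + b) + (-1, -(v : ℤ))) =
      coeff s (φ ^ n) := by
    rw [hs']
    simp [walkProb]
  rw [e1] at hN
  rw [e1, e2]
  set C := coeff (s + v) (φ ^ (n + 1)) with hC
  have hC0 : 0 < C := (Real.exp_pos _).trans_le hN
  set R := coeff s (φ ^ n) / C with hR
  have hCR : C * R = coeff s (φ ^ n) := by rw [hR]; field_simp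
  -- taking logarithms in Jensen's inequality; it is used for `t = θ` and `t = -θ`
  have key : ∀ t : ℝ, R * t ≤ Real.exp t - 1 + θ ^ 2 := by
    intro t
    have h := exp_mul_coeff_pow_le hφ.nonneg hφ.hasSum_one v n s t R hCR
    have h2 := (mul_le_mul_of_nonneg_left hN (Real.exp_pos _).le).trans h
    rw [← Real.exp_add, Real.exp_le_exp] at h2
    push_cast at h2
    have h3 : ((n : ℝ) + 1) * coeff v φ * (R * t) ≤
        ((n : ℝ) + 1) * coeff v φ * (Real.exp t - 1 + θ ^ 2) := by linarith
    exact le_of_mul_le_mul_left h3 (by positivity)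
  have h1 := key θ
  have h2 := key (-θ)
  have h3 := (abs_le.1 (Real.abs_exp_sub_one_sub_id_le (x := θ) (by rwa [abs_of_pos hθ]))).2
  have h4 := (abs_le.1 (Real.abs_exp_sub_one_sub_id_le (x := -θ)
    (by rwa [abs_neg, abs_of_pos hθ]))).2
  rw [Real.dist_eq, abs_lt]
  have h5 : (1 - 2 * θ) * θ ≤ R * θ := by nlinarith
  have h6 : R * θ ≤ (1 + 2 * θ) * θ := by nlinarith
  have h7 := le_of_mul_le_mul_right h5 hθ
  have h8 := le_of_mul_le_mul_right h6 hθ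
  constructor <;> linarith

/-- The strong ratio limit theorem: the probabilities at two points with a fixed difference are
equivalent.  The differences for which this holds form a subgroup, which contains `(1, v)` for every
possible step `v`. -/
theorem tendsto_walkProb_add (hφ : IsCriticalSeries φ) {y : ℤ × ℤ} (hy : (φ.period : ℤ) ∣ y.2) :
    Tendsto (fun x => φ.walkProb (x + y) / φ.walkProb x) φ.walkFilter (𝓝 1) := by
  let H : AddSubgroup (ℤ × ℤ) :=
    { carrier := {y | (φ.period : ℤ) ∣ y.2 ∧
        Tendsto (fun x => φ.walkProb (x + y) / φ.walkProb x) φ.walkFilter (𝓝 1)}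
      zero_mem' := by
        refine ⟨by simp, tendsto_const_nhds.congr' ?_⟩
        filter_upwards [hφ.eventually_walkProb_pos] with x hx
        rw [add_zero, div_self hx.ne']
      add_mem' := by
        rintro y z ⟨hy, hy'⟩ ⟨hz, hz'⟩
        refine ⟨dvd_add hy hz, ?_⟩
        have := (hz'.comp (tendsto_add_walkFilter hy)).mul hy'
        rw [mul_one] at this
        refine this.congr' ?_
        filter_upwards [(tendsto_add_walkFilter hy).eventually hφ.eventually_walkProb_pos]
          with x hx
        simp only [Function.comp, ← add_assoc]
        rw [div_mul_div_cancel₀ hx.ne']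
      neg_mem' := by
        rintro y ⟨hy, hy'⟩
        have hy2 : (φ.period : ℤ) ∣ (-y).2 := (dvd_neg).2 hy
        refine ⟨hy2, ?_⟩
        have := (hy'.comp (tendsto_add_walkFilter hy2)).inv₀ one_ne_zero
        rw [inv_one] at this
        refine this.congr fun x => ?_
        simp only [Function.comp, neg_add_cancel_right, inv_div] }
  have hstep : ∀ v : ℕ, coeff v φ ≠ 0 → ((1 : ℤ), (v : ℤ)) ∈ H := fun v hv => by
    have : ((-1 : ℤ), -(v : ℤ)) ∈ H :=
      ⟨(dvd_neg).2 (Int.natCast_dvd_natCast.2 (Nat.setGcd_dvd_of_mem hv)),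
        hφ.tendsto_walkProb_sub_step hv⟩
    simpa using H.neg_mem this
  have htime : ((1 : ℤ), (0 : ℤ)) ∈ H := by
    simpa using hstep 0 hφ.coeff_zero_pos.ne'
  have hclosure : ∀ r ∈ AddSubmonoid.closure {j | coeff j φ ≠ 0}, ((0 : ℤ), (r : ℤ)) ∈ H := by
    intro r hr
    induction hr using AddSubmonoid.closure_induction with
    | mem x hx => simpa using H.sub_mem (hstep x hx) htime
    | zero => exact H.zero_mem
    | add x y _ _ hx hy => simpa using H.add_mem hx hy
  have hperiod : ((0 : ℤ), (φ.period : ℤ)) ∈ H := by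
    obtain ⟨N, hN⟩ := Nat.exists_mem_closure_of_ge {j | coeff j φ ≠ 0}
    have hd : 1 ≤ φ.period := by
      obtain ⟨v, hv2, hv⟩ := hφ.exists_two_le
      have : φ.period ∣ v := Nat.setGcd_dvd_of_mem hv.ne'
      exact Nat.pos_of_dvd_of_pos this (by omega)
    have h1 := hclosure _ (hN (φ.period * N) (Nat.le_mul_of_pos_left N hd) (dvd_mul_right _ _))
    have h2 := hclosure _ (hN (φ.period * (N + 1)) ((Nat.le_succ N).trans
      (Nat.le_mul_of_pos_left (N + 1) hd)) (dvd_mul_right _ _))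
    have := H.sub_mem h2 h1
    simpa [mul_add] using this
  obtain ⟨k, hk⟩ := hy
  have hmem : y.1 • ((1 : ℤ), (0 : ℤ)) + k • ((0 : ℤ), (φ.period : ℤ)) ∈ H :=
    H.add_mem (H.zsmul_mem htime _) (H.zsmul_mem hperiod _)
  have e : y.1 • ((1 : ℤ), (0 : ℤ)) + k • ((0 : ℤ), (φ.period : ℤ)) = y := by
    ext
    · simp
    · simp [hk, mul_comm]
  rw [e] at hmem
  exact hmem.2

end IsCriticalSeries

/-! ### The Otter–Dwass formula and the total progeny of a forest -/

/-- `A` is the generating series of the total progeny of a Galton–Watson tree whose offspring law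
has generating series `φ`: it solves `A = X * φ(A)`, which is stated on the coefficients, where only
finitely many terms of `φ(A)` matter. -/
structure IsProgenySeries (φ A : PowerSeries ℝ) : Prop where
  coeff_zero : PowerSeries.coeff 0 A = 0
  coeff_succ : ∀ n, PowerSeries.coeff (n + 1) A =
    ∑ k ∈ Finset.range (n + 1), PowerSeries.coeff k φ * PowerSeries.coeff n (A ^ k)

namespace IsProgenySeries

open PowerSeries

variable {φ A : PowerSeries ℝ}

theorem coeff_pow_of_lt (hA : IsProgenySeries φ A) {n k : ℕ} (h : n < k) :
    coeff n (A ^ k) = 0 := by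
  obtain ⟨B, hB⟩ : X ∣ A := X_dvd_iff.2 (by simpa using hA.coeff_zero)
  rw [hB, mul_pow, coeff_X_pow_mul', if_neg (by omega)]

/-- The recursion obtained by exploring one vertex of a forest. -/
theorem coeff_pow_succ (hA : IsProgenySeries φ A) (j k : ℕ) :
    coeff (j + k + 1) (A ^ (k + 1)) =
      ∑ x ∈ Finset.HasAntidiagonal.antidiagonal j, coeff x.1 φ * coeff (j + k) (A ^ (x.1 + k)) := by
  set n := j + k with hn
  have h1 : coeff (n + 1) (A ^ (k + 1)) =
      coeff n ((∑ i ∈ Finset.range (n + 1), coeff i φ • A ^ i) * A ^ k) := by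
    rw [pow_succ', coeff_mul, Finset.Nat.antidiagonal_succ, Finset.sum_cons, coeff_mul]
    simp only [hA.coeff_zero, zero_mul, zero_add, Finset.sum_map, Function.Embedding.prodMap,
      Function.Embedding.coeFn_mk, Prod.map, Function.Embedding.refl_apply, Nat.succ_eq_add_one,
      hA.coeff_succ, map_sum, coeff_smul, smul_eq_mul]
    refine Finset.sum_congr rfl fun x hx => ?_
    congr 1
    have hxn : x.1 ≤ n := by
      rw [Finset.HasAntidiagonal.mem_antidiagonal] at hx
      omega
    refine Finset.sum_subset (Finset.range_subset_range.2 (by omega)) fun i _ hi => ?_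
    rw [hA.coeff_pow_of_lt (by simpa using hi), mul_zero]
  rw [h1, Finset.sum_mul, map_sum,
    Finset.Nat.sum_antidiagonal_eq_sum_range_succ
      (fun a _ => coeff a φ * coeff n (A ^ (a + k)))]
  simp only [smul_mul_assoc, ← pow_add, coeff_smul, smul_eq_mul]
  symm
  refine Finset.sum_subset (Finset.range_subset_range.2 (by omega)) fun i _ hi => ?_
  rw [hA.coeff_pow_of_lt (by simp at hi; omega), mul_zero]

/-- The Otter–Dwass formula: a forest of `k` trees has `n` vertices with probability `k / n` times
the probability that the walk is at `n - k` at time `n`.  By induction, exploring one vertex of the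
forest; the exchangeability of the steps gives the induction step. -/
theorem otter_dwass (hA : IsProgenySeries φ A) (n : ℕ) : ∀ j k : ℕ, j + k = n →
    (n : ℝ) * coeff n (A ^ k) = k * coeff j (φ ^ n) := by
  induction n with
  | zero =>
    intro j k h
    obtain ⟨rfl, rfl⟩ : j = 0 ∧ k = 0 := by omega
    simp
  | succ n ih =>
    intro j k h
    cases k with
    | zero =>
      obtain rfl : j = n + 1 := by omega
      rw [pow_zero, coeff_one, if_neg (by omega)]
      simp
    | succ k =>
      obtain rfl : j + k = n := by omega
      rcases Nat.eq_zero_or_pos (j + k) with h0 | hpos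
      · obtain ⟨rfl, rfl⟩ : j = 0 ∧ k = 0 := by omega
        simp [hA.coeff_succ]
      rw [hA.coeff_pow_succ]
      have e1 : ((j + k : ℕ) : ℝ) * ∑ x ∈ Finset.HasAntidiagonal.antidiagonal j,
          coeff x.1 φ * coeff (j + k) (A ^ (x.1 + k)) =
          k * coeff j (φ ^ (j + k + 1)) + coeff j (φ ^ (j + k) * (X * d⁄dX ℝ φ)) := by
        rw [pow_succ', mul_comm _ (X * _), coeff_mul, coeff_mul, Finset.mul_sum, Finset.mul_sum,
          ← Finset.sum_add_distrib]
        refine Finset.sum_congr rfl fun x hx => ?_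
        rw [Finset.HasAntidiagonal.mem_antidiagonal] at hx
        rw [mul_left_comm, ih x.2 (x.1 + k) (by omega), coeff_X_mul_derivative]
        push_cast
        ring
      have e2 := coeff_pow_mul_X_mul_derivative φ (j + k) j
      have hpos' : ((j + k : ℕ) : ℝ) ≠ 0 := by exact_mod_cast hpos.ne'
      apply mul_left_cancel₀ hpos'
      rw [mul_left_comm, e1]
      push_cast at e2 ⊢
      linear_combination e2

theorem coeff_nonneg (hφ : IsCriticalSeries φ) (hA : IsProgenySeries φ A) (n : ℕ) :
    0 ≤ coeff n A := by
  cases n with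
  | zero => exact hA.coeff_zero.ge
  | succ n =>
    have h := hA.otter_dwass (n + 1) n 1 rfl
    rw [pow_one] at h
    have h2 := coeff_pow_nonneg hφ.nonneg (n + 1) n
    have h3 : (0 : ℝ) < (n + 1 : ℕ) := by positivity
    by_contra! hneg
    nlinarith

theorem period_dvd_of_coeff_pow_ne_zero (hA : IsProgenySeries φ A) {n k : ℕ}
    (h : coeff n (A ^ k) ≠ 0) : (φ.period : ℤ) ∣ n - k := by
  have hkn : k ≤ n := by
    by_contra! hlt
    exact h (hA.coeff_pow_of_lt hlt)
  obtain ⟨j, rfl⟩ := Nat.exists_eq_add_of_le' hkn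
  have hd := hA.otter_dwass (j + k) j k rfl
  rcases Nat.eq_zero_or_pos j with rfl | hj
  · simp
  have hne : coeff j (φ ^ (j + k)) ≠ 0 := by
    intro h0
    rw [h0, mul_zero, mul_eq_zero] at hd
    rcases hd with hd | hd
    · have : j + k = 0 := by exact_mod_cast hd
      omega
    · exact h hd
  push_cast
  rw [add_sub_cancel_right]
  exact Int.natCast_dvd_natCast.2 (PowerSeries.period_dvd_of_coeff_pow_ne_zero hne)

theorem mul_coeff_pow_eq_walkProb (hA : IsProgenySeries φ A) {n k : ℕ} (h : k ≤ n) :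
    (n : ℝ) * coeff n (A ^ k) = k * φ.walkProb ((n : ℤ), (n : ℤ) - k) := by
  obtain ⟨j, rfl⟩ := Nat.exists_eq_add_of_le' h
  rw [hA.otter_dwass (j + k) j k rfl]
  simp only [walkProb, Nat.cast_add, add_sub_cancel_right, Int.toNat_natCast]
  congr 3

theorem eventually_coeff_pos (hφ : IsCriticalSeries φ) (hA : IsProgenySeries φ A) :
    ∀ᶠ n : ℕ in atTop, (φ.period : ℤ) ∣ n - 1 → 0 < coeff n A := by
  filter_upwards [eventually_walkFilter.1 hφ.eventually_walkProb_pos (-1), eventually_ge_atTop 1]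
    with n hn hn1 hd
  have h := hA.mul_coeff_pow_eq_walkProb hn1
  simp only [pow_one, Nat.cast_one, one_mul] at h
  have h2 := hn hd
  rw [← sub_eq_add_neg] at h2
  have h3 : 0 < (n : ℝ) * coeff n A := by rw [h]; exact h2
  exact pos_of_mul_pos_right h3 (Nat.cast_nonneg n)

/-- A forest of `z` trees has `n - m` vertices with a probability equivalent to `z` times the
probability that one tree has `n` vertices.  Both vanish if `n - 1` is not a multiple of the
period. -/
theorem eventually_abs_coeff_pow_sub_le (hφ : IsCriticalSeries φ) (hA : IsProgenySeries φ A)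
    {m z : ℕ} (hmz : (φ.period : ℤ) ∣ m + z - 1) {ε : ℝ} (hε : 0 < ε) :
    ∀ᶠ n : ℕ in atTop, |coeff (n - m) (A ^ z) - z * coeff n A| ≤ ε * coeff n A := by
  rcases Nat.eq_zero_or_pos z with rfl | hz
  · filter_upwards [eventually_gt_atTop m] with n hn
    rw [pow_zero, coeff_one, if_neg (by omega), Nat.cast_zero, zero_mul, sub_zero, abs_zero]
    exact mul_nonneg hε.le (coeff_nonneg hφ hA n)
  have hshift : (φ.period : ℤ) ∣ ((-m, 1 - m - z) : ℤ × ℤ).2 := by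
    have : (1 - m - z : ℤ) = -(m + z - 1) := by ring
    simpa only [this, dvd_neg] using hmz
  have hratio : Tendsto (fun n : ℕ => φ.walkProb ((n : ℤ) - m, (n : ℤ) - m - z) /
      φ.walkProb ((n : ℤ), (n : ℤ) - 1))
      (atTop ⊓ 𝓟 {n : ℕ | (φ.period : ℤ) ∣ n + (-1)}) (𝓝 1) := by
    have h1 : Tendsto (fun n : ℕ => ((n : ℤ), (n : ℤ) + (-1)))
        (atTop ⊓ 𝓟 {n : ℕ | (φ.period : ℤ) ∣ n + (-1)}) φ.walkFilter :=
      (le_iSup (fun b : ℤ => map (fun n : ℕ => ((n : ℤ), (n : ℤ) + b))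
        (atTop ⊓ 𝓟 {n : ℕ | (φ.period : ℤ) ∣ n + b})) (-1) :)
    refine ((hφ.tendsto_walkProb_add hshift).comp h1).congr fun n => ?_
    simp only [Function.comp, Prod.mk_add_mk]
    have e : (n : ℤ) + (-1) + (1 - m - z) = n - m - z := by ring
    rw [e, ← sub_eq_add_neg, ← sub_eq_add_neg]
  have hfrac : Tendsto (fun n : ℕ => (n : ℝ) / ((n - m : ℕ) : ℝ))
      (atTop ⊓ 𝓟 {n : ℕ | (φ.period : ℤ) ∣ n + (-1)}) (𝓝 1) := by
    refine Tendsto.mono_left ?_ inf_le_left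
    have := tendsto_natCast_div_add_atTop (m : ℝ) (𝕜 := ℝ)
    have := ((this.comp (tendsto_sub_atTop_nat m)).inv₀ one_ne_zero)
    rw [inv_one] at this
    refine this.congr' ?_
    filter_upwards [eventually_ge_atTop m] with n hn
    simp only [Function.comp, inv_div]
    rw [Nat.cast_sub hn, sub_add_cancel]
  have hlim := (hfrac.mul hratio).const_mul (z : ℝ)
  rw [one_mul, mul_one] at hlim
  have hev := Metric.tendsto_nhds.1 hlim ε hε
  rw [eventually_inf_principal] at hev
  filter_upwards [hev, eventually_coeff_pos hφ hA, eventually_ge_atTop (m + z)]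
    with n hn hpos hnm
  by_cases hd : (φ.period : ℤ) ∣ n - 1
  · have hα := hpos hd
    have hn := hn (by simpa [sub_eq_add_neg] using hd)
    have e1 := hA.mul_coeff_pow_eq_walkProb (show z ≤ n - m by omega)
    have e2 := hA.mul_coeff_pow_eq_walkProb (show 1 ≤ n by omega)
    have hcast : ((n - m : ℕ) : ℤ) = n - m := by omega
    rw [hcast] at e1
    rw [pow_one, Nat.cast_one, one_mul, Nat.cast_one] at e2
    rw [← e2] at hn
    have hnm0 : ((n - m : ℕ) : ℝ) ≠ 0 := by
      have : n - m ≠ 0 := by omega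
      exact_mod_cast this
    have hn0 : (n : ℝ) ≠ 0 := by
      have : n ≠ 0 := by omega
      exact_mod_cast this
    have e3 : (z : ℝ) * (n / ((n - m : ℕ) : ℝ) *
        (φ.walkProb ((n : ℤ) - m, (n : ℤ) - m - z) / (n * coeff n A))) =
        coeff (n - m) (A ^ z) / coeff n A := by
      have hα0 := hα.ne'
      field_simp
      linear_combination -e1
    rw [e3, Real.dist_eq] at hn
    have e4 : coeff (n - m) (A ^ z) - z * coeff n A =
        (coeff (n - m) (A ^ z) / coeff n A - z) * coeff n A := by
      have hα0 := hα.ne'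
      field_simp
    rw [e4, abs_mul, abs_of_pos hα]
    exact mul_le_mul_of_nonneg_right hn.le hα.le
  · have h1 : coeff n A = 0 := by
      by_contra hne
      rw [← pow_one A] at hne
      exact hd (by simpa using hA.period_dvd_of_coeff_pow_ne_zero hne)
    have h2 : coeff (n - m) (A ^ z) = 0 := by
      by_contra hne
      have h3 := hA.period_dvd_of_coeff_pow_ne_zero hne
      have hcast : ((n - m : ℕ) : ℤ) = n - m := by omega
      rw [hcast] at h3
      have := dvd_add h3 hmz
      apply hd
      rwa [show (n : ℤ) - 1 = n - m - z + (m + z - 1) by ring]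
    simp [h1, h2]

end IsProgenySeries

/-! ### Trees, cylinders and the local topology -/

namespace PlaneTree

theorem append_singleton_mem_iff {t : PlaneTree} {u : List ℕ} (hu : u ∈ t.verts) (i : ℕ) :
    u ++ [i] ∈ t.verts ↔ i < t.outdegree u := by
  obtain ⟨k, hk⟩ := t.exists_children u hu
  have : t.outdegree u = k := by
    have e : {i : ℕ | u ++ [i] ∈ t.verts} = ((Finset.range k : Finset ℕ) : Set ℕ) := by
      ext i
      simp [hk]
    rw [outdegree, e, Set.ncard_coe_finset, Finset.card_range]
  rw [this, hk]

theorem singleton_mem_iff (t : PlaneTree) (i : ℕ) : [i] ∈ t.verts ↔ i < t.outdegree [] :=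
  append_singleton_mem_iff t.root_mem i

theorem outdegree_eq_iff {t : PlaneTree} {k : ℕ} :
    t.outdegree [] = k ↔ ∀ i, [i] ∈ t.verts ↔ i < k := by
  simp only [singleton_mem_iff]
  refine ⟨fun h i => by rw [h], fun h => ?_⟩
  by_contra hne
  rcases Nat.lt_or_gt_of_ne hne with h1 | h1
  · exact lt_irrefl _ ((h _).2 h1)
  · exact lt_irrefl _ ((h _).1 h1)

theorem mem_subtree_iff {t : PlaneTree} {u v : List ℕ} (hu : u ∈ t.verts) :
    v ∈ (t.subtree u).verts ↔ u ++ v ∈ t.verts := by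
  rw [subtree, dif_pos hu]
  rfl

theorem subtree_of_notMem {t : PlaneTree} {u : List ℕ} (hu : u ∉ t.verts) :
    t.subtree u = trivial := by
  rw [subtree, dif_neg hu]

theorem cons_mem_iff (t : PlaneTree) (i : ℕ) (v : List ℕ) :
    i :: v ∈ t.verts ↔ i < t.outdegree [] ∧ v ∈ (t.subtree [i]).verts := by
  constructor
  · intro h
    have hi : [i] ∈ t.verts := t.ancestor_mem [i] v h
    exact ⟨(singleton_mem_iff t i).1 hi, (mem_subtree_iff hi).2 h⟩
  · rintro ⟨h1, h2⟩
    exact (mem_subtree_iff ((singleton_mem_iff t i).2 h1)).1 h2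

theorem restrict_eq_iff {s t : PlaneTree} {h : ℕ} :
    restrict h s = restrict h t ↔ ∀ u : List ℕ, u.length ≤ h → (u ∈ s.verts ↔ u ∈ t.verts) := by
  constructor
  · intro e u hu
    have := congrArg (fun r => u ∈ r.verts) e
    simpa [restrict, hu] using this
  · intro H
    ext u
    simp only [restrict, Set.mem_ofPred_eq]
    exact and_congr_left fun hu => H u hu

theorem restrict_succ_eq_iff {s t : PlaneTree} {h : ℕ} :
    restrict (h + 1) s = restrict (h + 1) t ↔ s.outdegree [] = t.outdegree [] ∧
      ∀ i < t.outdegree [], restrict h (s.subtree [i]) = restrict h (t.subtree [i]) := by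
  simp only [restrict_eq_iff]
  constructor
  · intro H
    have hout : s.outdegree [] = t.outdegree [] :=
      outdegree_eq_iff.2 fun i => by rw [H [i] (by simp), singleton_mem_iff]
    refine ⟨hout, fun i hi u hu => ?_⟩
    have := H (i :: u) (by simpa using hu)
    simpa only [cons_mem_iff, hout, hi, true_and] using this
  · rintro ⟨hout, H⟩ u hu
    cases u with
    | nil => exact ⟨fun _ => t.root_mem, fun _ => s.root_mem⟩
    | cons i u =>
      rw [cons_mem_iff, cons_mem_iff, hout]
      exact and_congr_right fun hi => H i hi u (by simpa using hu)

theorem restrict_subtree_eq {s t : PlaneTree} {h : ℕ}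
    (e : restrict (h + 1) s = restrict (h + 1) t) (i : ℕ) :
    restrict h (s.subtree [i]) = restrict h (t.subtree [i]) := by
  obtain ⟨hout, H⟩ := restrict_succ_eq_iff.1 e
  by_cases hi : i < t.outdegree []
  · exact H i hi
  · rw [subtree_of_notMem (u := [i]) (by rwa [singleton_mem_iff, hout]),
      subtree_of_notMem (u := [i]) (by rwa [singleton_mem_iff])]

theorem size_eq (t : PlaneTree) :
    t.size = 1 + ∑ i : Fin (t.outdegree []), (t.subtree [(i : ℕ)]).size := by
  have e : t.verts = insert []
      (⋃ i : Fin (t.outdegree []), List.cons (i : ℕ) '' (t.subtree [(i : ℕ)]).verts) := by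
    ext u
    cases u with
    | nil => simp [t.root_mem]
    | cons i u =>
      rw [cons_mem_iff]
      simp only [Set.mem_insert_iff, List.cons_ne_nil, false_or, Set.mem_iUnion, Set.mem_image,
        List.cons.injEq]
      constructor
      · rintro ⟨hi, hu⟩
        exact ⟨⟨i, hi⟩, u, hu, rfl, rfl⟩
      · rintro ⟨k, v, hv, rfl, rfl⟩
        exact ⟨k.2, hv⟩
  have hdisj : Pairwise (Function.onFun Disjoint
      fun i : Fin (t.outdegree []) => List.cons (i : ℕ) '' (t.subtree [(i : ℕ)]).verts) := by
    intro i j hij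
    refine Set.disjoint_left.2 ?_
    rintro _ ⟨u, _, rfl⟩ ⟨v, _, huv⟩
    exact hij (Fin.ext (List.cons.inj huv).1.symm)
  rw [size, e, Set.encard_insert_of_notMem (by simp), Set.encard_iUnion_of_finite hdisj,
    finsum_eq_sum_of_fintype, add_comm]
  congr 1
  exact Finset.sum_congr rfl fun i _ => List.cons_injective.encard_image _

theorem finite_restrict (h : ℕ) (t : PlaneTree) : (restrict h t).verts.Finite := by
  induction h generalizing t with
  | zero =>
    refine (Set.finite_singleton []).subset fun u hu => ?_
    exact List.length_eq_zero_iff.1 (Nat.le_zero.1 hu.2)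
  | succ h ih =>
    have : (restrict (h + 1) t).verts ⊆ insert []
        (⋃ i ∈ Finset.range (t.outdegree []),
          List.cons i '' (restrict h (t.subtree [i])).verts) := by
      rintro u ⟨hu, hlen⟩
      cases u with
      | nil => exact Set.mem_insert _ _
      | cons i u =>
        rw [cons_mem_iff] at hu
        refine Set.mem_insert_of_mem _ (Set.mem_biUnion (Finset.mem_coe.2 (Finset.mem_range.2 hu.1))
          ⟨u, ⟨hu.2, by simpa using hlen⟩, rfl⟩)
    refine Set.Finite.subset (Set.Finite.insert _ ?_) this
    exact (Finset.finite_toSet _).biUnion fun i _ => (ih _).image _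

theorem countable_range_restrict (h : ℕ) : (Set.range (restrict h)).Countable := by
  have hinj : Function.Injective (PlaneTree.verts) := fun s t e => PlaneTree.ext e
  refine Set.MapsTo.countable_of_injOn (f := PlaneTree.verts) (t := {s | s.Finite}) ?_
    hinj.injOn Set.Countable.ofPred_finite
  rintro _ ⟨t, rfl⟩
  exact finite_restrict h t

/-- The trees which agree with `t` up to height `h`. -/
def heightCylinder (h : ℕ) (t : PlaneTree) : Set PlaneTree := {s | restrict h s = restrict h t}

theorem heightCylinder_succ_eq (h : ℕ) (t : PlaneTree) :
    heightCylinder (h + 1) t = {s | s.outdegree [] = t.outdegree [] ∧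
      ∀ i : Fin (t.outdegree []),
        s.subtree [(i : ℕ)] ∈ heightCylinder h (t.subtree [(i : ℕ)])} := by
  ext s
  simp only [heightCylinder, Set.mem_ofPred_eq, restrict_succ_eq_iff, Fin.forall_iff]

theorem heightCylinder_zero_eq (t : PlaneTree) : heightCylinder 0 t = Set.univ :=
  Set.eq_univ_of_forall fun s => restrict_zero s t

theorem dist_le_pow_iff {s t : PlaneTree} {h : ℕ} :
    dist s t ≤ (2⁻¹ : ℝ) ^ h ↔ restrict h s = restrict h t := by
  by_cases hne : s = t
  · subst hne
    simp only [tree_dist_self, iff_true]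
    positivity
  rw [dist_eq hne, pow_le_pow_iff_right_of_lt_one₀ (by norm_num) (by norm_num)]
  constructor
  · intro hle
    exact restrict_mono hle (Nat.sSup_mem ⟨0, restrict_zero s t⟩ (bddAbove_restrict_eq hne))
  · intro e
    exact le_csSup (bddAbove_restrict_eq hne) e

theorem isOpen_iff_heightCylinder {U : Set PlaneTree} :
    IsOpen U ↔ ∀ t ∈ U, ∃ h, heightCylinder h t ⊆ U := by
  rw [Metric.isOpen_iff]
  refine forall₂_congr fun t _ => ⟨?_, ?_⟩
  · rintro ⟨ε, hε, hU⟩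
    obtain ⟨h, hh⟩ := exists_pow_lt_of_lt_one hε (show (2⁻¹ : ℝ) < 1 by norm_num)
    exact ⟨h, fun s hs => hU (Metric.mem_ball.2 ((dist_le_pow_iff.2 hs).trans_lt hh))⟩
  · rintro ⟨h, hU⟩
    exact ⟨(2⁻¹ : ℝ) ^ h, by positivity, fun s hs =>
      hU (dist_le_pow_iff.1 (Metric.mem_ball.1 hs).le)⟩

theorem isOpen_heightCylinder (h : ℕ) (t : PlaneTree) : IsOpen (heightCylinder h t) :=
  isOpen_iff_heightCylinder.2 fun s hs => ⟨h, fun r hr =>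
    (show restrict h r = restrict h s from hr).trans hs⟩

theorem isOpen_outdegree_eq (k : ℕ) : IsOpen {t : PlaneTree | t.outdegree [] = k} :=
  isOpen_iff_heightCylinder.2 fun _ ht => ⟨1, fun _ hr => (restrict_succ_eq_iff.1 hr).1.trans ht⟩

theorem continuous_subtree (i : ℕ) : Continuous fun t : PlaneTree => t.subtree [i] := by
  refine continuous_def.2 fun U hU => isOpen_iff_heightCylinder.2 fun t ht => ?_
  obtain ⟨h, hh⟩ := isOpen_iff_heightCylinder.1 hU _ ht
  exact ⟨h + 1, fun r hr => hh (restrict_subtree_eq hr i)⟩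

theorem isOpen_le_size (n : ℕ) : IsOpen {t : PlaneTree | (n : ℕ∞) ≤ t.size} := by
  refine isOpen_iff_heightCylinder.2 fun t ht => ?_
  obtain ⟨F, hF, hFn⟩ := Set.exists_subset_encard_eq ht
  have hfin : F.Finite := Set.finite_of_encard_eq_coe hFn
  refine ⟨hfin.toFinset.sup List.length, fun r hr => ?_⟩
  change (n : ℕ∞) ≤ r.verts.encard
  rw [← hFn]
  refine Set.encard_le_encard fun u hu => ?_
  exact (restrict_eq_iff.1 hr u (Finset.le_sup (f := List.length) (by simpa using hu))).2 (hF hu)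

theorem measurableSet_le_size (n : ℕ) : MeasurableSet {t : PlaneTree | (n : ℕ∞) ≤ t.size} :=
  (isOpen_le_size n).measurableSet

theorem measurableSet_size_eq (n : ℕ) : MeasurableSet {t : PlaneTree | t.size = n} := by
  have : {t : PlaneTree | t.size = n} =
      {t : PlaneTree | (n : ℕ∞) ≤ t.size} \ {t : PlaneTree | ((n + 1 : ℕ) : ℕ∞) ≤ t.size} := by
    ext t
    simp only [Set.mem_ofPred_eq, Set.mem_sdiff, not_le, Nat.cast_add, Nat.cast_one]
    rw [le_antisymm_iff, and_comm, ← ENat.lt_add_one_iff (ENat.natCast_ne_top n)]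
  rw [this]
  exact (measurableSet_le_size n).diff (measurableSet_le_size (n + 1))

/-- The number of vertices of `t` at height less than `h`. -/
noncomputable def innerCount : ℕ → PlaneTree → ℕ
  | 0, _ => 0
  | h + 1, t => 1 + ∑ i ∈ Finset.range (t.outdegree []), innerCount h (t.subtree [i])

/-- The number of vertices of `t` at height `h`. -/
noncomputable def levelCount : ℕ → PlaneTree → ℕ
  | 0, _ => 1
  | h + 1, t => ∑ i ∈ Finset.range (t.outdegree []), levelCount h (t.subtree [i])

/-- The product of the probabilities of the numbers of children of the vertices of `t` at height
less than `h`. -/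
noncomputable def weight (p : PMF ℕ) : ℕ → PlaneTree → ℝ
  | 0, _ => 1
  | h + 1, t => (p (t.outdegree [])).toReal *
      ∏ i ∈ Finset.range (t.outdegree []), weight p h (t.subtree [i])

theorem weight_nonneg (p : PMF ℕ) (h : ℕ) (t : PlaneTree) : 0 ≤ weight p h t := by
  induction h generalizing t with
  | zero => exact zero_le_one
  | succ h ih => exact mul_nonneg ENNReal.toReal_nonneg (Finset.prod_nonneg fun i _ => ih _)

/-- If the numbers of children are multiples of `d`, then the number of vertices up to height `h`
is congruent to `1` modulo `d`. -/
theorem dvd_innerCount_add_levelCount {p : PMF ℕ} {d : ℕ} (hd : ∀ k, p k ≠ 0 → d ∣ k) (h : ℕ)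
    (t : PlaneTree) (hw : weight p h t ≠ 0) :
    (d : ℤ) ∣ innerCount h t + levelCount h t - 1 := by
  induction h generalizing t with
  | zero => simp [innerCount, levelCount]
  | succ h ih =>
    have hk : p (t.outdegree []) ≠ 0 := fun h0 => hw (by simp [weight, h0])
    have e : ((innerCount (h + 1) t : ℕ) : ℤ) + (levelCount (h + 1) t : ℕ) - 1 =
        ∑ i ∈ Finset.range (t.outdegree []), ((innerCount h (t.subtree [i]) : ℤ) +
          levelCount h (t.subtree [i]) - 1) + t.outdegree [] := by
      simp only [innerCount, levelCount, Finset.sum_sub_distrib, Finset.sum_add_distrib]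
      push_cast
      simp
      ring
    rw [e]
    refine dvd_add (Finset.dvd_sum fun i hi => ih _ fun h0 => hw ?_)
      (Int.natCast_dvd_natCast.2 (hd _ hk))
    rw [weight, Finset.prod_eq_zero hi h0, mul_zero]

end PlaneTree

/-! ### Weak convergence and the branching property -/

namespace PlaneTree

theorem measurableSet_heightCylinder (h : ℕ) (t : PlaneTree) : MeasurableSet (heightCylinder h t) :=
  (isOpen_heightCylinder h t).measurableSet

/-- The generating series of the sizes of the trees in `B`. -/
noncomputable def sizeSeries (μ : Measure PlaneTree) (B : Set PlaneTree) : PowerSeries ℝ :=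
  PowerSeries.mk fun n => μ.real (B ∩ {t | t.size = n})

theorem coeff_sizeSeries (μ : Measure PlaneTree) (B : Set PlaneTree) (n : ℕ) :
    PowerSeries.coeff n (sizeSeries μ B) = μ.real (B ∩ {t | t.size = n}) :=
  PowerSeries.coeff_mk _ _

theorem coeff_zero_sizeSeries (μ : Measure PlaneTree) (B : Set PlaneTree) :
    PowerSeries.coeff 0 (sizeSeries μ B) = 0 := by
  rw [coeff_sizeSeries]
  have : B ∩ {t : PlaneTree | t.size = (0 : ℕ)} = ∅ := by
    refine Set.eq_empty_of_forall_notMem fun t ht => ?_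
    have h := ht.2
    simp only [Set.mem_ofPred_eq, size_eq t, Nat.cast_zero, add_eq_zero, one_ne_zero,
      false_and] at h
  rw [this, measureReal_empty]

/-- For the local topology, weak convergence follows from the convergence of the probabilities of
the cylinders: there are countably many of them, and an open set is, up to a small mass, a finite
disjoint union of cylinders of the same height. -/
theorem le_liminf_measure_of_tendsto_heightCylinder {μ : Measure PlaneTree}
    {μs : ℕ → Measure PlaneTree}
    (hlim : ∀ h t, Tendsto (fun n => μs n (heightCylinder h t)) atTop (𝓝 (μ (heightCylinder h t))))
    {G : Set PlaneTree} (hG : IsOpen G) : μ G ≤ liminf (fun n => μs n G) atTop := by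
  -- the union of the cylinders of height `h` contained in `G`
  set V : ℕ → Set PlaneTree := fun h => {t | heightCylinder h t ⊆ G} with hV
  have hVmono : Monotone V := fun h k hhk t ht s hs => ht (restrict_mono hhk hs)
  have hVG : G = ⋃ h, V h := by
    ext t
    rw [Set.mem_iUnion]
    exact ⟨fun ht => isOpen_iff_heightCylinder.1 hG t ht, fun ⟨h, ht⟩ => ht rfl⟩
  have key : ∀ h, μ (V h) ≤ liminf (fun n => μs n G) atTop := by
    intro h
    set R : Set PlaneTree := restrict h '' V h with hR
    have hRc : R.Countable := (countable_range_restrict h).mono (Set.image_subset_range _ _)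
    have hdisj : R.PairwiseDisjoint fun r => {s | restrict h s = r} := by
      intro r _ r' _ hne
      refine Set.disjoint_left.2 fun s hs hs' => hne ?_
      exact (show restrict h s = r from hs).symm.trans hs'
    have hmeas : ∀ r ∈ R, MeasurableSet {s | restrict h s = r} := by
      rintro _ ⟨t, _, rfl⟩
      exact measurableSet_heightCylinder h t
    have hVR : V h = ⋃ r ∈ R, {s | restrict h s = r} := by
      ext s
      simp only [Set.mem_iUnion, exists_prop]
      constructor
      · intro hs
        exact ⟨_, ⟨s, hs, rfl⟩, rfl⟩
      · rintro ⟨_, ⟨t, ht, rfl⟩, hst⟩ r hr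
        exact ht ((show restrict h r = restrict h s from hr).trans hst)
    rw [hVR, measure_biUnion hRc hdisj hmeas, ENNReal.tsum_eq_iSup_sum]
    refine iSup_le fun F => ?_
    have hF : Tendsto (fun n => ∑ r ∈ F, μs n {s | restrict h s = r}) atTop
        (𝓝 (∑ r ∈ F, μ {s | restrict h s = r})) := by
      refine tendsto_finsetSum _ fun r _ => ?_
      obtain ⟨t, _, ht⟩ := r.2
      rw [← ht]
      exact hlim h t
    rw [← hF.liminf_eq]
    refine liminf_le_liminf (Eventually.of_forall fun n => ?_)
    rw [← measure_biUnion_finset (s := F) (f := fun r : R => {s | restrict h s = (r : PlaneTree)})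
      (fun r _ r' _ hne => hdisj r.2 r'.2 fun e => hne (Subtype.ext e))
      fun r _ => hmeas r r.2]
    refine measure_mono ?_
    rw [hVG]
    refine Set.Subset.trans ?_ (Set.subset_iUnion V h)
    rw [hVR]
    exact Set.iUnion₂_subset fun r _ =>
      Set.subset_biUnion_of_mem (u := fun r => {s | restrict h s = r}) r.2
  conv_lhs => rw [hVG, hVmono.measure_iUnion]
  exact iSup_le key

end PlaneTree

/-- If the variables `X i` are independent conditionally on the event `E`, the probability of `E`
and of events on the `X i` is a product. -/
theorem ProbabilityTheory.iIndepFun.measure_inter_iInter_eq {Ω ι 𝓧 : Type*} [Fintype ι]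
    [MeasurableSpace Ω] [MeasurableSpace 𝓧] {P : Measure Ω} [IsFiniteMeasure P] {E : Set Ω}
    (hE : NullMeasurableSet E P) (hE0 : P E ≠ 0) {X : ι → Ω → 𝓧} (hX : iIndepFun X (P[|E]))
    {B : ι → Set 𝓧} (hB : ∀ i, MeasurableSet (B i)) :
    P (E ∩ ⋂ i, X i ⁻¹' B i) = P E * ∏ i, P[|E] (X i ⁻¹' B i) := by
  have h := hX.measure_inter_preimage_eq_mul Finset.univ (sets := B) fun i _ => hB i
  simp only [Finset.mem_univ, Set.iInter_true] at h
  rw [← h, ProbabilityTheory.cond, Measure.smul_apply, Measure.restrict_apply₀' hE, smul_eq_mul,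
    ← mul_assoc, ENNReal.mul_inv_cancel hE0 (measure_ne_top P E), one_mul, Set.inter_comm]

/-- The law of a Galton–Watson tree: the number of children of the root and the sub-trees above
them satisfy the product formula which expresses the branching property. -/
structure IsGaltonWatsonLaw (p : PMF ℕ) (μ : Measure PlaneTree) : Prop where
  isProbabilityMeasure : IsProbabilityMeasure μ
  branching : ∀ (k : ℕ) (B : Fin k → Set PlaneTree), (∀ i, MeasurableSet (B i)) →
    μ.real {t | t.outdegree [] = k ∧ ∀ i : Fin k, t.subtree [(i : ℕ)] ∈ B i} =
      (p k).toReal * ∏ i, μ.real (B i)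

theorem IsGaltonWatson.isGaltonWatsonLaw {Ω : Type*} [MeasurableSpace Ω] {p : PMF ℕ}
    {τ : Ω → PlaneTree} {P : Measure Ω} [IsProbabilityMeasure P] (hτ : IsGaltonWatson p τ P) :
    IsGaltonWatsonLaw p (P.map τ) where
  isProbabilityMeasure := Measure.isProbabilityMeasure_map hτ.aemeasurable
  branching k B hB := by
    have hout : MeasurableSet {t : PlaneTree | t.outdegree [] = k} :=
      (PlaneTree.isOpen_outdegree_eq k).measurableSet
    have hS : MeasurableSet
        {t : PlaneTree | t.outdegree [] = k ∧ ∀ i : Fin k, t.subtree [(i : ℕ)] ∈ B i} := by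
      refine hout.inter ?_
      have : {t : PlaneTree | ∀ i : Fin k, t.subtree [(i : ℕ)] ∈ B i} =
          ⋂ i : Fin k, (fun t : PlaneTree => t.subtree [(i : ℕ)]) ⁻¹' B i := by
        ext t
        simp
      change MeasurableSet {t : PlaneTree | ∀ i : Fin k, t.subtree [(i : ℕ)] ∈ B i}
      rw [this]
      exact MeasurableSet.iInter fun i =>
        (PlaneTree.continuous_subtree (i : ℕ)).measurable (hB i)
    rw [measureReal_def, Measure.map_apply_of_aemeasurable hτ.aemeasurable hS]
    have hofs := hτ.offspring k
    have hE : NullMeasurableSet {ω | (τ ω).outdegree [] = k} P :=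
      hτ.aemeasurable.nullMeasurableSet_preimage hout
    by_cases h0 : P {ω | (τ ω).outdegree [] = k} = 0
    · have h1 : P (τ ⁻¹' {t | t.outdegree [] = k ∧ ∀ i : Fin k, t.subtree [(i : ℕ)] ∈ B i}) = 0 :=
        measure_mono_null (fun ω hω => hω.1) h0
      rw [h1, ← hofs, h0]
      simp
    · have heq : τ ⁻¹' {t | t.outdegree [] = k ∧ ∀ i : Fin k, t.subtree [(i : ℕ)] ∈ B i} =
          {ω | (τ ω).outdegree [] = k} ∩
            ⋂ i : Fin k, (fun ω => (τ ω).subtree [(i : ℕ)]) ⁻¹' B i := by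
        ext ω
        simp
      rcases Nat.eq_zero_or_pos k with rfl | hk
      · rw [heq]
        simp [hofs]
      · obtain ⟨hind, hid⟩ := hτ.branching k hk h0
        rw [heq, hind.measure_inter_iInter_eq hE h0 hB, hofs, ENNReal.toReal_mul,
          ENNReal.toReal_prod]
        congr 1
        refine Finset.prod_congr rfl fun i _ => ?_
        rw [(hid i).measure_mem_eq (hB i), measureReal_def,
          Measure.map_apply_of_aemeasurable hτ.aemeasurable (hB i)]

namespace IsGaltonWatsonLaw

open PlaneTree

variable {p : PMF ℕ} {μ : Measure PlaneTree}

theorem measureReal_heightCylinder (hμ : IsGaltonWatsonLaw p μ) (h : ℕ) (t : PlaneTree) :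
    μ.real (heightCylinder h t) = weight p h t := by
  have := hμ.isProbabilityMeasure
  induction h generalizing t with
  | zero => rw [heightCylinder_zero_eq, weight, probReal_univ]
  | succ h ih =>
    rw [heightCylinder_succ_eq, hμ.branching _ _ fun i => measurableSet_heightCylinder h _, weight,
      Finset.prod_range]
    simp only [ih]

/-- The branching property for the generating series of the sizes. -/
theorem measureReal_inter_size_succ (hμ : IsGaltonWatsonLaw p μ) (k n : ℕ)
    (B : Fin k → Set PlaneTree) (hB : ∀ i, MeasurableSet (B i)) :
    μ.real ({t | t.outdegree [] = k ∧ ∀ i : Fin k, t.subtree [(i : ℕ)] ∈ B i} ∩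
      {t | t.size = ((n + 1 : ℕ) : ℕ∞)}) =
      (p k).toReal * PowerSeries.coeff n (∏ i, sizeSeries μ (B i)) := by
  have := hμ.isProbabilityMeasure
  -- decomposition according to the sizes `l i` of the sub-trees above the children of the root
  set D : (Fin k →₀ ℕ) → Set PlaneTree := fun l =>
    {t | t.outdegree [] = k ∧
      ∀ i : Fin k, t.subtree [(i : ℕ)] ∈ B i ∩ {t | t.size = (l i : ℕ)}} with hD
  have hBl : ∀ (l : Fin k →₀ ℕ) i, MeasurableSet (B i ∩ {t : PlaneTree | t.size = (l i : ℕ)}) :=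
    fun l i => (hB i).inter (measurableSet_size_eq _)
  have hDm : ∀ l, MeasurableSet (D l) := fun l => by
    have : D l = {t | t.outdegree [] = k} ∩ ⋂ i : Fin k,
        (fun t : PlaneTree => t.subtree [(i : ℕ)]) ⁻¹' (B i ∩ {t | t.size = (l i : ℕ)}) := by
      ext t
      simp [hD]
    rw [this]
    exact (isOpen_outdegree_eq k).measurableSet.inter
      (MeasurableSet.iInter fun i => (continuous_subtree (i : ℕ)).measurable (hBl l i))
  have hunion : {t | t.outdegree [] = k ∧ ∀ i : Fin k, t.subtree [(i : ℕ)] ∈ B i} ∩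
      {t | t.size = ((n + 1 : ℕ) : ℕ∞)} = ⋃ l ∈ Finset.finsuppAntidiag Finset.univ n, D l := by
    ext t
    simp only [Set.mem_inter_iff, Set.mem_ofPred_eq, Set.mem_iUnion, exists_prop,
      Finset.mem_finsuppAntidiag, Finset.subset_univ, and_true, hD]
    constructor
    · rintro ⟨⟨rfl, hBt⟩, hsize⟩
      rw [size_eq, Nat.cast_succ, add_comm (n : ℕ∞)] at hsize
      have hsum : ∑ i : Fin (t.outdegree []), (t.subtree [(i : ℕ)]).size = n :=
        ENat.add_right_injective_of_ne_top ENat.one_ne_top hsize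
      have hfin : ∀ i : Fin (t.outdegree []), (t.subtree [(i : ℕ)]).size ≠ ⊤ := fun i htop => by
        have := Finset.single_le_sum (f := fun i : Fin (t.outdegree []) =>
          (t.subtree [(i : ℕ)]).size) (fun _ _ => zero_le) (Finset.mem_univ i)
        rw [hsum, htop, top_le_iff] at this
        exact ENat.natCast_ne_top n this
      refine ⟨Finsupp.equivFunOnFinite.symm fun i => (t.subtree [(i : ℕ)]).size.toNat, ?_, rfl,
        fun i => ⟨hBt i, ?_⟩⟩
      · simp only [Finsupp.equivFunOnFinite_symm_apply_apply]
        have : ((∑ i : Fin (t.outdegree []), (t.subtree [(i : ℕ)]).size.toNat : ℕ) : ℕ∞) = n := by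
          rw [← hsum, Nat.cast_sum]
          exact Finset.sum_congr rfl fun i _ => ENat.natCast_toNat (hfin i)
        exact_mod_cast this
      · simp only [Finsupp.equivFunOnFinite_symm_apply_apply]
        exact (ENat.natCast_toNat (hfin i)).symm
    · rintro ⟨l, hl, rfl, hBl⟩
      refine ⟨⟨rfl, fun i => (hBl i).1⟩, ?_⟩
      rw [size_eq, Finset.sum_congr rfl fun i _ => (hBl i).2, ← Nat.cast_sum]
      rw [show ∑ i, l i = n from hl, Nat.cast_succ, add_comm]
  have hdisj : Set.PairwiseDisjoint
      (↑(Finset.finsuppAntidiag (Finset.univ : Finset (Fin k)) n)) D := by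
    intro l _ l' _ hne
    refine Set.disjoint_left.2 fun t ht ht' => hne (Finsupp.ext fun i => ?_)
    have h1 := (ht.2 i).2
    have h2 := (ht'.2 i).2
    simp only [Set.mem_ofPred_eq] at h1 h2
    exact_mod_cast h1.symm.trans h2
  rw [hunion, measureReal_biUnion_finset hdisj fun l _ => hDm l, PowerSeries.coeff_prod,
    Finset.mul_sum]
  refine Finset.sum_congr rfl fun l _ => ?_
  rw [hμ.branching k _ (hBl l)]
  simp only [coeff_sizeSeries]

/-- The generating series of the sizes of the trees in a cylinder: the vertices at height less
than `h` are prescribed, and independent Galton–Watson trees start from those at height `h`. -/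
theorem sizeSeries_heightCylinder (hμ : IsGaltonWatsonLaw p μ) (h : ℕ) (t : PlaneTree) :
    sizeSeries μ (heightCylinder h t) =
      weight p h t • (PowerSeries.X ^ innerCount h t * sizeSeries μ Set.univ ^ levelCount h t) := by
  induction h generalizing t with
  | zero => simp [heightCylinder_zero_eq, weight, innerCount, levelCount]
  | succ h ih =>
    have h1 : sizeSeries μ (heightCylinder (h + 1) t) = (p (t.outdegree [])).toReal •
        (PowerSeries.X * ∏ i : Fin (t.outdegree []),
          sizeSeries μ (heightCylinder h (t.subtree [(i : ℕ)]))) := by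
      ext n
      cases n with
      | zero => rw [coeff_zero_sizeSeries]; simp
      | succ n =>
        rw [coeff_sizeSeries, heightCylinder_succ_eq,
          hμ.measureReal_inter_size_succ _ n _ fun i => measurableSet_heightCylinder h _,
          PowerSeries.coeff_smul, PowerSeries.coeff_succ_X_mul, smul_eq_mul]
    rw [h1]
    simp only [ih, weight, innerCount, levelCount]
    rw [← Finset.prod_range (fun i => weight p h (t.subtree [i]) •
      (PowerSeries.X ^ innerCount h (t.subtree [i]) *
        sizeSeries μ Set.univ ^ levelCount h (t.subtree [i])))]
    simp only [PowerSeries.smul_eq_C_mul, Finset.prod_mul_distrib, Finset.prod_pow_eq_pow_sum,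
      map_mul, map_prod, pow_add, pow_one]
    ring

end IsGaltonWatsonLaw

/-! ### Size of a critical Galton–Watson tree and conditioning -/

theorem MeasureTheory.hasSum_measureReal_iUnion {α : Type*} [MeasurableSpace α] (μ : Measure α)
    [IsFiniteMeasure μ] {D : ℕ → Set α} (hd : Pairwise (Function.onFun Disjoint D))
    (hm : ∀ n, MeasurableSet (D n)) : HasSum (fun n => μ.real (D n)) (μ.real (⋃ n, D n)) := by
  have h := measure_iUnion (μ := μ) hd hm
  rw [measureReal_def, h, ENNReal.tsum_toReal_eq fun n => measure_ne_top μ _]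
  exact (ENNReal.summable_toReal (h ▸ measure_ne_top μ _)).hasSum

/-- The generating series of an offspring law. -/
noncomputable def offspringSeries (p : PMF ℕ) : PowerSeries ℝ :=
  PowerSeries.mk fun n => (p n).toReal

theorem coeff_offspringSeries (p : PMF ℕ) (n : ℕ) :
    PowerSeries.coeff n (offspringSeries p) = (p n).toReal :=
  PowerSeries.coeff_mk _ _

theorem hasSum_toReal_pmf (p : PMF ℕ) : HasSum (fun n => (p n).toReal) 1 := by
  have h := ENNReal.hasSum_toReal (f := p) (by rw [p.tsum_coe]; exact ENNReal.one_ne_top)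
  rwa [← ENNReal.tsum_toReal_eq fun n => p.apply_ne_top n, p.tsum_coe, ENNReal.toReal_one] at h

theorem hasSum_mul_toReal_pmf {p : PMF ℕ} (hm : offspringMean p = 1) :
    HasSum (fun n : ℕ => (n : ℝ) * (p n).toReal) 1 := by
  have hne : ∑' n : ℕ, (n : ℝ≥0∞) * p n ≠ ∞ := by
    rw [← offspringMean, hm]; exact ENNReal.one_ne_top
  have h := ENNReal.hasSum_toReal hne
  rw [← ENNReal.tsum_toReal_eq fun n => ENNReal.ne_top_of_tsum_ne_top hne n, ← offspringMean, hm,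
    ENNReal.toReal_one] at h
  simpa only [ENNReal.toReal_mul, ENNReal.toReal_natCast] using h

theorem exists_two_le_pmf_ne_zero {p : PMF ℕ} (hp01 : p 0 + p 1 < 1) : ∃ v, 2 ≤ v ∧ p v ≠ 0 := by
  by_contra! hcon
  have h := p.tsum_coe
  rw [tsum_eq_sum (s := Finset.range 2) fun n hn => hcon n (by simp at hn; omega)] at h
  simp only [Finset.sum_range_succ, Finset.sum_range_zero, zero_add] at h
  exact hp01.ne h

theorem isCriticalSeries_offspringSeries {p : PMF ℕ} (hp0 : 0 < p 0) (hp01 : p 0 + p 1 < 1)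
    (hm : offspringMean p = 1) : IsCriticalSeries (offspringSeries p) where
  nonneg j := by rw [coeff_offspringSeries]; exact ENNReal.toReal_nonneg
  hasSum_one := by simpa only [coeff_offspringSeries] using hasSum_toReal_pmf p
  hasSum_mean := by simpa only [coeff_offspringSeries] using hasSum_mul_toReal_pmf hm
  coeff_zero_pos := by
    rw [coeff_offspringSeries]
    exact ENNReal.toReal_pos hp0.ne' (p.apply_ne_top 0)
  exists_two_le := by
    obtain ⟨v, hv, hpv⟩ := exists_two_le_pmf_ne_zero hp01
    exact ⟨v, hv, by
      rw [coeff_offspringSeries]; exact ENNReal.toReal_pos hpv (p.apply_ne_top v)⟩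

/-- The period as a largest number is the greatest common divisor of the support. -/
theorem period_offspringSeries {p : PMF ℕ} (hp01 : p 0 + p 1 < 1) :
    (offspringSeries p).period = offspringPeriod p := by
  have hsupp : {j | PowerSeries.coeff j (offspringSeries p) ≠ 0} = p.support := by
    ext j
    simp [coeff_offspringSeries, ENNReal.toReal_eq_zero_iff, p.apply_ne_top j]
  have hset : {k : ℕ | p.toMeasure {n : ℕ | k ∣ n} = 1} =
      {k | k ∣ (offspringSeries p).period} := by
    ext k
    simp only [Set.mem_ofPred_eq, PowerSeries.period, Nat.dvd_setGcd_iff, hsupp]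
    rw [PMF.toMeasure_apply_eq_one_iff p (MeasurableSet.of_discrete)]
    rfl
  have hpos : 0 < (offspringSeries p).period := by
    obtain ⟨v, hv, hpv⟩ := exists_two_le_pmf_ne_zero hp01
    have hmem : v ∈ {j | PowerSeries.coeff j (offspringSeries p) ≠ 0} := by
      rw [hsupp]; exact hpv
    exact Nat.pos_of_dvd_of_pos (Nat.setGcd_dvd_of_mem hmem) (by omega)
  rw [offspringPeriod, hset]
  refine le_antisymm ?_ ?_
  · exact le_csSup ⟨_, fun k hk => Nat.le_of_dvd hpos hk⟩ (dvd_refl _)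
  · exact csSup_le ⟨_, dvd_refl _⟩ fun k hk => Nat.le_of_dvd hpos hk

namespace PlaneTree

theorem outdegree_add_one_le_size (t : PlaneTree) : ((t.outdegree [] : ℕ) : ℕ∞) + 1 ≤ t.size := by
  have h1 : ∀ s : PlaneTree, 1 ≤ s.size := fun s => by rw [size_eq]; exact le_self_add
  rw [size_eq, add_comm]
  refine add_le_add_right ?_ 1
  calc ((t.outdegree [] : ℕ) : ℕ∞) = ∑ _i : Fin (t.outdegree []), 1 := by simp
    _ ≤ _ := Finset.sum_le_sum fun i _ => h1 _

end PlaneTree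

namespace IsGaltonWatsonLaw

open PlaneTree

variable {p : PMF ℕ} {μ : Measure PlaneTree}

theorem isProgenySeries (hμ : IsGaltonWatsonLaw p μ) :
    IsProgenySeries (offspringSeries p) (sizeSeries μ Set.univ) where
  coeff_zero := coeff_zero_sizeSeries _ _
  coeff_succ n := by
    have := hμ.isProbabilityMeasure
    have hunion : Set.univ ∩ {t : PlaneTree | t.size = ((n + 1 : ℕ) : ℕ∞)} =
        ⋃ k ∈ Finset.range (n + 1), ({t : PlaneTree | t.outdegree [] = k ∧
          ∀ i : Fin k, t.subtree [(i : ℕ)] ∈ Set.univ} ∩ {t | t.size = ((n + 1 : ℕ) : ℕ∞)}) := by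
      ext t
      simp only [Set.mem_inter_iff, Set.mem_univ, true_and, Set.mem_iUnion, exists_prop,
        Set.mem_ofPred_eq, implies_true, and_true, Finset.mem_range]
      refine ⟨fun h => ⟨_, ?_, rfl, h⟩, fun ⟨_, _, _, h⟩ => h⟩
      have := outdegree_add_one_le_size t
      rw [h] at this
      exact_mod_cast this
    have hm : ∀ k : ℕ, MeasurableSet ({t : PlaneTree | t.outdegree [] = k ∧
        ∀ i : Fin k, t.subtree [(i : ℕ)] ∈ Set.univ} ∩ {t | t.size = ((n + 1 : ℕ) : ℕ∞)}) := by
      intro k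
      simp only [Set.mem_univ, implies_true, and_true]
      exact (isOpen_outdegree_eq k).measurableSet.inter (measurableSet_size_eq _)
    rw [coeff_sizeSeries, hunion, measureReal_biUnion_finset ?_ fun k _ => hm k]
    · refine Finset.sum_congr rfl fun k _ => ?_
      rw [hμ.measureReal_inter_size_succ k n _ fun i => MeasurableSet.univ, coeff_offspringSeries]
      simp
    · intro k _ l _ hne
      exact Set.disjoint_left.2 fun t ht ht' => hne (ht.1.1.symm.trans ht'.1.1)

/-- A critical Galton–Watson tree is finite.  The probability `q` of being finite satisfies
`∑ p k * q ^ k ≤ q`, whereas Bernoulli's inequality `1 - k (1 - q) ≤ q ^ k`, strict for `k ≥ 2` if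
`q < 1`, gives `q < ∑ p k * q ^ k`. -/
theorem measure_size_eq_top (hμ : IsGaltonWatsonLaw p μ) (hp01 : p 0 + p 1 < 1)
    (hm : offspringMean p = 1) : μ {t | t.size = ⊤} = 0 := by
  have := hμ.isProbabilityMeasure
  have hfin : MeasurableSet {t : PlaneTree | t.size ≠ ⊤} := by
    have : {t : PlaneTree | t.size ≠ ⊤} = ⋃ n : ℕ, {t | t.size = (n : ℕ∞)} := by
      ext t
      simp only [Set.mem_ofPred_eq, Set.mem_iUnion, ENat.ne_top_iff_exists]
      exact exists_congr fun n => eq_comm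
    rw [this]
    exact MeasurableSet.iUnion fun n => measurableSet_size_eq n
  set q := μ.real {t : PlaneTree | t.size ≠ ⊤} with hq
  have hq0 : 0 ≤ q := measureReal_nonneg
  have hq1 : q ≤ 1 := measureReal_le_one
  have hsum : ∀ F : Finset ℕ, ∑ k ∈ F, (p k).toReal * q ^ k ≤ q := by
    intro F
    have hterm : ∀ k, (p k).toReal * q ^ k = μ.real {t : PlaneTree | t.outdegree [] = k ∧
        ∀ i : Fin k, t.subtree [(i : ℕ)] ∈ {t : PlaneTree | t.size ≠ ⊤}} := fun k => by
      rw [hμ.branching k _ fun _ => hfin, Finset.prod_const, Finset.card_univ, Fintype.card_fin]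
    have hmk : ∀ k : ℕ, MeasurableSet {t : PlaneTree | t.outdegree [] = k ∧
        ∀ i : Fin k, t.subtree [(i : ℕ)] ∈ {t : PlaneTree | t.size ≠ ⊤}} := fun k => by
      have : {t : PlaneTree | t.outdegree [] = k ∧
          ∀ i : Fin k, t.subtree [(i : ℕ)] ∈ {t : PlaneTree | t.size ≠ ⊤}} =
          {t | t.outdegree [] = k} ∩ ⋂ i : Fin k,
            (fun t : PlaneTree => t.subtree [(i : ℕ)]) ⁻¹' {t : PlaneTree | t.size ≠ ⊤} := by
        ext t
        simp
      rw [this]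
      exact (isOpen_outdegree_eq k).measurableSet.inter
        (MeasurableSet.iInter fun i => (continuous_subtree (i : ℕ)).measurable hfin)
    simp only [hterm]
    rw [← measureReal_biUnion_finset ?_ fun k _ => hmk k]
    · refine measureReal_mono (Set.iUnion₂_subset fun k _ t ht => ?_)
      obtain ⟨rfl, ht⟩ := ht
      simp only [Set.mem_ofPred_eq] at ht ⊢
      rw [size_eq]
      simp [ht]
    · intro k _ l _ hne
      exact Set.disjoint_left.2 fun t ht ht' => hne (ht.1.symm.trans ht'.1)
  have hq1' : q = 1 := by
    by_contra hne
    have hlt : q < 1 := lt_of_le_of_ne hq1 hne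
    obtain ⟨v, hv, hpv⟩ := exists_two_le_pmf_ne_zero hp01
    have hpv' : 0 < (p v).toReal := ENNReal.toReal_pos hpv (p.apply_ne_top v)
    have hb : ∀ k : ℕ, 1 - k * (1 - q) ≤ q ^ k := fun k => by
      have := one_add_mul_le_pow (a := q - 1) (by linarith) k
      rw [add_sub_cancel] at this
      linarith
    have hbv : 1 - v * (1 - q) < q ^ v := by
      have := one_add_mul_self_lt_rpow_one_add (s := q - 1) (by linarith) (by linarith)
        (p := v) (by exact_mod_cast hv)
      rw [add_sub_cancel, Real.rpow_natCast] at this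
      linarith
    set c := (p v).toReal * (q ^ v - (1 - v * (1 - q))) with hc
    have hc0 : 0 < c := mul_pos hpv' (by linarith)
    have hS : HasSum (fun k : ℕ => (p k).toReal - (1 - q) * (k * (p k).toReal) +
        if k = v then c else 0) (1 - (1 - q) * 1 + c) :=
      ((hasSum_toReal_pmf p).sub ((hasSum_mul_toReal_pmf hm).mul_left (1 - q))).add
        (hasSum_ite_eq v c)
    have hle := hasSum_le_of_sum_le hS (c := q) fun F => ?_
    · linarith
    · refine le_trans (Finset.sum_le_sum fun k _ => ?_) (hsum F)
      split_ifs with h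
      · subst h
        rw [hc]
        exact le_of_eq (by ring)
      · have := mul_le_mul_of_nonneg_left (hb k) (ENNReal.toReal_nonneg (a := p k))
        linarith
  have hcompl : {t : PlaneTree | t.size = ⊤} = {t : PlaneTree | t.size ≠ ⊤}ᶜ := by
    ext t
    simp
  rw [hcompl, prob_compl_eq_zero_iff hfin]
  rw [hq, measureReal_def, ENNReal.toReal_eq_one_iff] at hq1'
  exact hq1'

theorem hasSum_measureReal_inter (hμ : IsGaltonWatsonLaw p μ) {B E : Set PlaneTree} {J : Set ℕ}
    (hB : MeasurableSet B) (hE : E =ᵐ[μ] {t | ∃ N ∈ J, t.size = (N : ℕ∞)}) :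
    HasSum (J.indicator fun N => PowerSeries.coeff N (sizeSeries μ B)) (μ.real (B ∩ E)) := by
  have := hμ.isProbabilityMeasure
  classical
  have hcongr : μ.real (B ∩ E) =
      μ.real (⋃ N, if N ∈ J then B ∩ {t | t.size = (N : ℕ∞)} else ∅) := by
    have hset : (⋃ N, if N ∈ J then B ∩ {t : PlaneTree | t.size = (N : ℕ∞)} else ∅) =
        B ∩ {t | ∃ N ∈ J, t.size = (N : ℕ∞)} := by
      ext t
      simp only [Set.mem_iUnion, Set.mem_inter_iff, Set.mem_ofPred_eq]
      constructor
      · rintro ⟨N, hN⟩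
        split_ifs at hN with h
        · exact ⟨hN.1, N, h, hN.2⟩
        · exact absurd hN (Set.notMem_empty t)
      · rintro ⟨hB, N, hN, h⟩
        exact ⟨N, by rw [if_pos hN]; exact ⟨hB, h⟩⟩
    rw [hset]
    exact measureReal_congr ((ae_eq_refl B).inter hE)
  rw [hcongr]
  refine (hasSum_measureReal_iUnion μ ?_ ?_).congr_fun ?_
  · intro M N hne
    refine Set.disjoint_left.2 fun t ht ht' => hne ?_
    beta_reduce at ht ht'
    split_ifs at ht ht' with h1 h2
    · exact_mod_cast (ht.2 : t.size = M).symm.trans ht'.2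
    all_goals simp_all
  · intro N
    split_ifs
    · exact hB.inter (measurableSet_size_eq N)
    · exact MeasurableSet.empty
  · intro N
    by_cases h : N ∈ J
    · rw [Set.indicator_of_mem h, if_pos h, coeff_sizeSeries]
    · rw [Set.indicator_of_notMem h, if_neg h, measureReal_empty]

/-- The local limit of the law of a critical Galton–Watson tree conditioned on its size being in
`J n`, for any sets `J n` of integers which are at least `n`: the probability of the cylinder of `t`
of height `h` converges to its probability before conditioning, multiplied by the number of
vertices of `t` at height `h`. -/
theorem tendsto_cond_heightCylinder (hμ : IsGaltonWatsonLaw p μ) (hp0 : 0 < p 0)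
    (hp01 : p 0 + p 1 < 1) (hm : offspringMean p = 1) {E : ℕ → Set PlaneTree} {J : ℕ → Set ℕ}
    (hJ : ∀ n, ∀ N ∈ J n, n ≤ N) (hE : ∀ n, E n =ᵐ[μ] {t | ∃ N ∈ J n, t.size = (N : ℕ∞)})
    (hpos : ∀ᶠ n in atTop, μ (E n) ≠ 0) (h : ℕ) (t : PlaneTree) :
    Tendsto (fun n => μ.real (heightCylinder h t ∩ E n) / μ.real (E n)) atTop
      (𝓝 (levelCount h t * weight p h t)) := by
  have := hμ.isProbabilityMeasure
  have hφ := isCriticalSeries_offspringSeries hp0 hp01 hm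
  have hA := hμ.isProgenySeries
  set A := sizeSeries μ Set.univ with hAdef
  set w := weight p h t with hw
  set z := levelCount h t with hz
  have hw0 : 0 ≤ w := weight_nonneg p h t
  -- the convergence along sizes, uniformly in the sizes that are large
  have hkey : ∀ ε > 0, ∀ᶠ N : ℕ in atTop,
      |PowerSeries.coeff N (sizeSeries μ (heightCylinder h t)) - z * w * PowerSeries.coeff N A| ≤
        ε * PowerSeries.coeff N A := by
    intro ε hε
    rcases hw0.eq_or_lt with hw0 | hwpos
    · refine Eventually.of_forall fun N => ?_
      rw [hμ.sizeSeries_heightCylinder, ← hw, ← hw0]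
      simpa using mul_nonneg hε.le (IsProgenySeries.coeff_nonneg hφ hA N)
    · have hdvd : ((offspringSeries p).period : ℤ) ∣ innerCount h t + levelCount h t - 1 :=
        dvd_innerCount_add_levelCount (fun k hk => Nat.setGcd_dvd_of_mem (by
          rw [Set.mem_ofPred_eq, coeff_offspringSeries]
          exact (ENNReal.toReal_pos hk (p.apply_ne_top k)).ne')) h t hwpos.ne'
      filter_upwards [IsProgenySeries.eventually_abs_coeff_pow_sub_le hφ hA hdvd
        (show 0 < ε / w by positivity), eventually_ge_atTop (innerCount h t)] with N hN hN2
      rw [hμ.sizeSeries_heightCylinder, PowerSeries.coeff_smul, PowerSeries.coeff_X_pow_mul',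
        if_pos hN2, smul_eq_mul]
      have e : w * PowerSeries.coeff (N - innerCount h t) (A ^ z) -
          z * w * PowerSeries.coeff N A = w * (PowerSeries.coeff (N - innerCount h t) (A ^ z) -
            z * PowerSeries.coeff N A) := by ring
      rw [e, abs_mul, abs_of_pos hwpos]
      calc _ ≤ w * (ε / w * PowerSeries.coeff N A) := mul_le_mul_of_nonneg_left hN hwpos.le
        _ = _ := by field_simp
  rw [Metric.tendsto_nhds]
  intro ε hε
  obtain ⟨N₀, hN₀⟩ := eventually_atTop.1 (hkey (ε / 2) (by positivity))
  filter_upwards [hpos, eventually_ge_atTop N₀] with n hn hnN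
  have hE0 : 0 < μ.real (E n) := ENNReal.toReal_pos hn (measure_ne_top μ _)
  have h1 := hμ.hasSum_measureReal_inter (measurableSet_heightCylinder h t) (hE n)
  have h2 := hμ.hasSum_measureReal_inter MeasurableSet.univ (hE n)
  rw [Set.univ_inter] at h2
  have hup := hasSum_le (fun N => ?_) h1 (h2.mul_left (z * w + ε / 2))
  · have hlo := hasSum_le (fun N => ?_) (h2.mul_left (z * w - ε / 2)) h1
    · have e : μ.real (heightCylinder h t ∩ E n) / μ.real (E n) - z * w =
          (μ.real (heightCylinder h t ∩ E n) - z * w * μ.real (E n)) / μ.real (E n) := by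
        field_simp
      rw [Real.dist_eq, e, abs_div, abs_of_pos hE0, div_lt_iff₀ hE0, abs_lt]
      constructor <;> nlinarith
    · by_cases hN : N ∈ J n
      · rw [Set.indicator_of_mem hN, Set.indicator_of_mem hN]
        have := (abs_le.1 (hN₀ N (hnN.trans (hJ n N hN)))).1
        linarith
      · rw [Set.indicator_of_notMem hN, Set.indicator_of_notMem hN, mul_zero]
  · by_cases hN : N ∈ J n
    · rw [Set.indicator_of_mem hN, Set.indicator_of_mem hN]
      have := (abs_le.1 (hN₀ N (hnN.trans (hJ n N hN)))).2
      linarith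
    · rw [Set.indicator_of_notMem hN, Set.indicator_of_notMem hN, mul_zero]

end IsGaltonWatsonLaw

/-! ### Kesten's tree and the local limit -/

theorem TypedTree.measurableSet_rootOffspring (n i : ℕ) :
    MeasurableSet {x : TypedTree | x.RootOffspring n i} := by
  have h1 : MeasurableSet {x : TypedTree | x.1.outdegree [] = n} :=
    measurable_fst (PlaneTree.isOpen_outdegree_eq n).measurableSet
  have h2 : ∀ j, MeasurableSet {x : TypedTree | [j] ∈ x.2 ↔ j = i} := fun j => by
    have hj : MeasurableSet {x : TypedTree | [j] ∈ x.2} :=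
      measurable_snd (measurableSet_mem ([j] : List ℕ))
    by_cases h : j = i
    · simpa only [h, iff_true] using h ▸ hj
    · simp only [h, iff_false]
      exact hj.compl
  have : {x : TypedTree | x.RootOffspring n i} = {x : TypedTree | x.1.outdegree [] = n} ∩
      ⋂ j ∈ Finset.range n, {x : TypedTree | [j] ∈ x.2 ↔ j = i} := by
    ext x
    simp [TypedTree.RootOffspring]
  rw [this]
  exact h1.inter (Finset.measurableSet_biInter _ fun j _ => h2 j)

namespace IsSpecialTypedTree

open PlaneTree

variable {Ω : Type*} [MeasurableSpace Ω] {p : PMF ℕ} {X : Ω → TypedTree} {P : Measure Ω}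

theorem nullMeasurableSet_rootOffspring (hX : IsSpecialTypedTree p X P) (n i : ℕ) :
    NullMeasurableSet {ω | (X ω).RootOffspring n i} P :=
  hX.aemeasurable.nullMeasurableSet_preimage (TypedTree.measurableSet_rootOffspring n i)

theorem measure_rootOffspring (hX : IsSpecialTypedTree p X P) (hm : offspringMean p = 1)
    {n i : ℕ} (hi : i < n) : P {ω | (X ω).RootOffspring n i} = p n := by
  rw [hX.offspring n i hi, sizeBiased, hm, div_one, mul_right_comm,
    ENNReal.mul_inv_cancel (by exact_mod_cast (by omega : n ≠ 0)) (ENNReal.natCast_ne_top n),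
    one_mul]

/-- Almost surely, exactly one child of the root is special: the probabilities of the possible
offspring configurations of the root sum up to the mean `1` of `p`. -/
theorem ae_exists_rootOffspring [IsProbabilityMeasure P] (hX : IsSpecialTypedTree p X P)
    (hm : offspringMean p = 1) : ∀ᵐ ω ∂P, ∃ n, ∃ i < n, (X ω).RootOffspring n i := by
  have hdisj : Pairwise (Function.onFun (AEDisjoint P)
      fun x : Σ n : ℕ, Fin n => {ω | (X ω).RootOffspring x.1 x.2}) := by
    rintro ⟨n, i⟩ ⟨m, j⟩ hne
    refine Disjoint.aedisjoint (Set.disjoint_left.2 fun ω hω hω' => hne ?_)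
    obtain rfl : n = m := hω.1.symm.trans hω'.1
    have := ((hω'.2 i i.2).1 ((hω.2 i i.2).2 rfl))
    rw [Fin.ext this]
  have hU := measure_iUnion₀ hdisj fun x => hX.nullMeasurableSet_rootOffspring x.1 x.2
  have hone : P (⋃ x : Σ n : ℕ, Fin n, {ω | (X ω).RootOffspring x.1 x.2}) = 1 := by
    rw [hU, ENNReal.tsum_sigma (fun n (i : Fin n) => P {ω | (X ω).RootOffspring n i}), ← hm,
      offspringMean]
    refine tsum_congr fun n => ?_
    rw [tsum_fintype, Finset.sum_congr rfl fun i _ => hX.measure_rootOffspring hm i.2]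
    simp
  have hnull := NullMeasurableSet.iUnion fun x : Σ n : ℕ, Fin n =>
    hX.nullMeasurableSet_rootOffspring x.1 x.2
  rw [← prob_compl_eq_zero_iff₀ hnull] at hone
  rw [ae_iff]
  refine measure_mono_null ?_ hone
  intro ω hω hU
  apply hω
  obtain ⟨x, hx⟩ := Set.mem_iUnion.1 hU
  exact ⟨x.1, x.2, x.2.2, hx⟩

/-- The law of Kesten's tree up to height `h` is the law of the Galton–Watson tree biased by the
number of vertices at height `h`. -/
theorem measureReal_heightCylinder [IsProbabilityMeasure P] (hX : IsSpecialTypedTree p X P)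
    (hm : offspringMean p = 1) (h : ℕ) (t : PlaneTree) :
    P.real {ω | (X ω).1 ∈ heightCylinder h t} = levelCount h t * weight p h t := by
  induction h generalizing t with
  | zero =>
    simp [heightCylinder_zero_eq, levelCount, weight]
  | succ h ih =>
    set k := t.outdegree [] with hk
    have hnull : ∀ i : Fin k, NullMeasurableSet ({ω | (X ω).RootOffspring k i} ∩
        {ω | (X ω).1 ∈ heightCylinder (h + 1) t}) P := fun i =>
      (hX.nullMeasurableSet_rootOffspring k i).inter
        (hX.aemeasurable.nullMeasurableSet_preimage
          (measurable_fst (measurableSet_heightCylinder (h + 1) t)))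
    have hae : {ω | (X ω).1 ∈ heightCylinder (h + 1) t} =ᵐ[P]
        ⋃ i ∈ (Finset.univ : Finset (Fin k)), ({ω | (X ω).RootOffspring k i} ∩
          {ω | (X ω).1 ∈ heightCylinder (h + 1) t} : Set Ω) := by
      filter_upwards [hX.ae_exists_rootOffspring hm] with ω hω
      refine propext ⟨fun ht => ?_, fun ht => ?_⟩
      · obtain ⟨n, i, hi, hni⟩ := hω
        have hkn : n = k := by
          have ht' : (X ω).1 ∈ heightCylinder (h + 1) t := ht
          rw [heightCylinder_succ_eq] at ht'
          exact hni.1.symm.trans ht'.1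
        subst hkn
        exact Set.mem_iUnion₂.2 ⟨⟨i, hi⟩, Finset.mem_univ _, hni, ht⟩
      · obtain ⟨i, _, hi⟩ := Set.mem_iUnion₂.1 ht
        exact hi.2
    have hterm : ∀ i : Fin k, P.real ({ω | (X ω).RootOffspring k i} ∩
        {ω | (X ω).1 ∈ heightCylinder (h + 1) t}) =
        levelCount h (t.subtree [(i : ℕ)]) * weight p (h + 1) t := by
      intro i
      have hE := hX.measure_rootOffspring hm i.2
      by_cases h0 : P {ω | (X ω).RootOffspring k i} = 0
      · rw [measureReal_def, measure_mono_null Set.inter_subset_left h0, weight, ← hk, ← hE, h0]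
        simp
      obtain ⟨hind, hlaw⟩ := hX.branching k i i.2 h0
      have := cond_isProbabilityMeasure h0
      have hset : {ω | (X ω).RootOffspring k i} ∩ {ω | (X ω).1 ∈ heightCylinder (h + 1) t} =
          {ω | (X ω).RootOffspring k i} ∩ ⋂ j : Fin k, (fun ω => (X ω).subtree [(j : ℕ)]) ⁻¹'
            (Prod.fst ⁻¹' heightCylinder h (t.subtree [(j : ℕ)])) := by
        ext ω
        simp only [Set.mem_inter_iff, Set.mem_ofPred_eq, Set.mem_iInter, Set.mem_preimage,
          heightCylinder_succ_eq, TypedTree.subtree]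
        exact and_congr_right fun hω => ⟨fun H => H.2, fun H => ⟨hω.1, H⟩⟩
      have hB : ∀ j : Fin k, MeasurableSet
          (Prod.fst ⁻¹' heightCylinder h (t.subtree [(j : ℕ)]) : Set TypedTree) := fun j =>
        measurable_fst (measurableSet_heightCylinder h _)
      have hfac : ∀ j : Fin k, (P[|{ω | (X ω).RootOffspring k i}]
          ((fun ω => (X ω).subtree [(j : ℕ)]) ⁻¹'
            (Prod.fst ⁻¹' heightCylinder h (t.subtree [(j : ℕ)])))).toReal =
          (if j = i then (levelCount h (t.subtree [(j : ℕ)]) : ℝ) else 1) *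
            weight p h (t.subtree [(j : ℕ)]) := by
        intro j
        by_cases hji : j = i
        · rw [if_pos hji, ((hlaw j).1 (by rw [hji])).measure_mem_eq (hB j)]
          exact ih _
        · rw [if_neg hji, one_mul]
          have hn := ((hlaw j).2 fun e => hji (Fin.ext e)).galtonWatson
          rw [← hn.isGaltonWatsonLaw.measureReal_heightCylinder, measureReal_def,
            Measure.map_apply_of_aemeasurable hn.aemeasurable (measurableSet_heightCylinder h _)]
          rfl
      rw [hset, measureReal_def, hind.measure_inter_iInter_eq
        (hX.nullMeasurableSet_rootOffspring k i) h0 hB, hE, ENNReal.toReal_mul,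
        ENNReal.toReal_prod, Finset.prod_congr rfl fun j _ => hfac j, Finset.prod_mul_distrib,
        Finset.prod_ite_eq' Finset.univ i, if_pos (Finset.mem_univ i), weight, Finset.prod_range]
      ring
    rw [measureReal_congr hae, measureReal_biUnion_finset₀ ?_ fun i _ => hnull i,
      Finset.sum_congr rfl fun i _ => hterm i, ← Finset.sum_mul, levelCount, Finset.sum_range]
    · push_cast
      rfl
    · intro i _ j _ hne
      refine Disjoint.aedisjoint (Set.disjoint_left.2 fun ω hω hω' => hne (Fin.ext ?_))
      exact (hω'.1.2 i i.2).1 ((hω.1.2 i i.2).2 rfl)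

end IsSpecialTypedTree

theorem IsGaltonWatson.map_cond_heightCylinder {Ω : Type*} [MeasurableSpace Ω] {p : PMF ℕ}
    {τ : Ω → PlaneTree} {P : Measure Ω} [IsProbabilityMeasure P] (hτ : IsGaltonWatson p τ P)
    {E : Set PlaneTree} (hE : MeasurableSet E) (h : ℕ) (t : PlaneTree) :
    ((P[|τ ⁻¹' E]).map τ).real (PlaneTree.heightCylinder h t) =
      (P.map τ).real (PlaneTree.heightCylinder h t ∩ E) / (P.map τ).real E := by
  have hC := PlaneTree.measurableSet_heightCylinder h t
  rw [measureReal_def, Measure.map_apply_of_aemeasurable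
    (hτ.aemeasurable.mono_ac cond_absolutelyContinuous) hC, ProbabilityTheory.cond,
    Measure.smul_apply, Measure.restrict_apply₀' (hτ.aemeasurable.nullMeasurableSet_preimage hE),
    smul_eq_mul, ENNReal.toReal_mul, ENNReal.toReal_inv, measureReal_def, measureReal_def,
    Measure.map_apply_of_aemeasurable hτ.aemeasurable hE,
    Measure.map_apply_of_aemeasurable hτ.aemeasurable (hC.inter hE), Set.preimage_inter,
    inv_mul_eq_div]

/-- Convergence to Kesten's tree for a critical Galton–Watson tree conditioned on the size being in
`J n`, for any sets `J n` of integers which are at least `n`. -/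
theorem tendstoInDistribution_kestenTree {p : PMF ℕ} (hp0 : 0 < p 0) (hp01 : p 0 + p 1 < 1)
    (hm : offspringMean p = 1) {Ω : Type*} [MeasurableSpace Ω] {P : Measure Ω}
    [IsProbabilityMeasure P] {τ : Ω → PlaneTree} (hτ : IsGaltonWatson p τ P)
    {Ω' : Type*} [MeasurableSpace Ω'] {P' : Measure Ω'} [IsProbabilityMeasure P']
    {τ' : Ω' → PlaneTree} (hτ' : IsKestenTree p τ' P')
    {Ωs : ℕ → Type*} [∀ n, MeasurableSpace (Ωs n)] {Q : (n : ℕ) → Measure (Ωs n)}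
    [∀ n, IsProbabilityMeasure (Q n)] {σ : (n : ℕ) → Ωs n → PlaneTree}
    (hσ : ∀ n, AEMeasurable (σ n) (Q n)) {E : ℕ → Set PlaneTree} {J : ℕ → Set ℕ}
    (hEm : ∀ n, MeasurableSet (E n)) (hJ : ∀ n, ∀ N ∈ J n, n ≤ N)
    (hE : ∀ n, E n =ᵐ[P.map τ] {t | ∃ N ∈ J n, t.size = (N : ℕ∞)})
    (hpos : ∀ᶠ n in atTop, 0 < P (τ ⁻¹' E n))
    (hlaw : ∀ᶠ n : ℕ in atTop, HasLaw (σ n) ((P[|τ ⁻¹' E n]).map τ) (Q n)) :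
    TendstoInDistribution σ atTop τ' Q P' := by
  obtain ⟨s, hX⟩ := hτ'
  have hτ'm : AEMeasurable τ' P' := measurable_fst.comp_aemeasurable hX.aemeasurable
  have hμ := hτ.isGaltonWatsonLaw
  have hpos' : ∀ᶠ n in atTop, (P.map τ) (E n) ≠ 0 := hpos.mono fun n hn => by
    rw [Measure.map_apply_of_aemeasurable hτ.aemeasurable (hEm n)]
    exact hn.ne'
  refine ⟨hσ, hτ'm, tendsto_of_forall_isOpen_le_liminf_nat' fun G hG =>
    PlaneTree.le_liminf_measure_of_tendsto_heightCylinder (fun h t => ?_) hG⟩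
  have hlim := hμ.tendsto_cond_heightCylinder hp0 hp01 hm hJ hE hpos' h t
  have hK := hX.measureReal_heightCylinder hm h t
  have hC := PlaneTree.measurableSet_heightCylinder h t
  have : IsProbabilityMeasure (P'.map τ') := Measure.isProbabilityMeasure_map hτ'm
  have hQ : ∀ n, IsProbabilityMeasure ((Q n).map (σ n)) := fun n =>
    Measure.isProbabilityMeasure_map (hσ n)
  have hK' : (P'.map τ').real (PlaneTree.heightCylinder h t) =
      PlaneTree.levelCount h t * PlaneTree.weight p h t := by
    rw [measureReal_def, Measure.map_apply_of_aemeasurable hτ'm hC]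
    exact hK
  rw [← hK'] at hlim
  change Tendsto (fun n => (Q n).map (σ n) (PlaneTree.heightCylinder h t)) atTop
    (𝓝 (P'.map τ' (PlaneTree.heightCylinder h t)))
  refine (ENNReal.tendsto_toReal_iff (fun n => measure_ne_top _ _) (measure_ne_top _ _)).1 ?_
  refine hlim.congr' ?_
  filter_upwards [hlaw] with n hn
  rw [← hτ.map_cond_heightCylinder (hEm n), ← hn.map_eq]
  rfl

theorem mainTheorem6 (p : PMF ℕ)
    (hp0 : 0 < p 0) (hp0' : p 0 < 1) (hp01 : p 0 + p 1 < 1) (hm : offspringMean p = 1)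
    {Ω : Type*} [MeasurableSpace Ω] (P : Measure Ω) [IsProbabilityMeasure P]
    (τ : Ω → PlaneTree) (hτ : IsGaltonWatson p τ P)
    {Ω' : Type*} [MeasurableSpace Ω'] (P' : Measure Ω') [IsProbabilityMeasure P']
    (τ' : Ω' → PlaneTree) (hτ' : IsKestenTree p τ' P')
    {Ωs : ℕ → Type*} [∀ n, MeasurableSpace (Ωs n)] (Q : (n : ℕ) → Measure (Ωs n))
    [∀ n, IsProbabilityMeasure (Q n)]
    (σ : (n : ℕ) → Ωs n → PlaneTree) (hσ : ∀ n, AEMeasurable (σ n) (Q n)) :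
    ((∀ᶠ n : ℕ in atTop, 0 < P {ω | (n : ℕ∞) ≤ (τ ω).size ∧
        (τ ω).size < (n : ℕ∞) + (offspringPeriod p : ℕ∞)}) ∧
      ((∀ᶠ n : ℕ in atTop, HasLaw (σ n)
          ((P[|{ω | (n : ℕ∞) ≤ (τ ω).size ∧
            (τ ω).size < (n : ℕ∞) + (offspringPeriod p : ℕ∞)}]).map τ) (Q n)) →
        TendstoInDistribution σ atTop τ' Q P')) ∧
    ((∀ n : ℕ, 0 < P {ω | (n : ℕ∞) ≤ (τ ω).size}) ∧
      ((∀ᶠ n : ℕ in atTop, HasLaw (σ n)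
          ((P[|{ω | (n : ℕ∞) ≤ (τ ω).size}]).map τ) (Q n)) →
        TendstoInDistribution σ atTop τ' Q P')) := by
  have hμ := hτ.isGaltonWatsonLaw
  have hφ := isCriticalSeries_offspringSeries hp0 hp01 hm
  have hA := hμ.isProgenySeries
  set d := offspringPeriod p with hd
  have hperiod : (offspringSeries p).period = d := period_offspringSeries hp01
  have hdpos : 0 < d := by
    obtain ⟨v, hv, hpv⟩ := hφ.exists_two_le
    have : (offspringSeries p).period ∣ v := Nat.setGcd_dvd_of_mem hpv.ne'
    rw [hperiod] at this
    exact Nat.pos_of_dvd_of_pos this (by omega)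
  -- an interval of length `d` contains a size congruent to `1` modulo `d`
  have hpos : ∀ᶠ n : ℕ in atTop, 0 < P {ω | (n : ℕ∞) ≤ (τ ω).size ∧
      (τ ω).size < (n : ℕ∞) + (d : ℕ∞)} := by
    obtain ⟨n₀, hn₀⟩ := eventually_atTop.1 (IsProgenySeries.eventually_coeff_pos hφ hA)
    filter_upwards [eventually_ge_atTop n₀] with n hn
    obtain ⟨N, hnN, hNd, hdvd⟩ : ∃ N : ℕ, n ≤ N ∧ N < n + d ∧ (d : ℤ) ∣ N - 1 := by
      have hd0 : (d : ℤ) ≠ 0 := by omega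
      have h1 := Int.emod_nonneg (1 - (n : ℤ)) hd0
      have h2 := Int.emod_lt_of_pos (1 - (n : ℤ)) (show (0 : ℤ) < d by omega)
      have h3 := Int.emod_add_mul_ediv (1 - (n : ℤ)) d
      refine ⟨n + ((1 - (n : ℤ)) % d).toNat, by omega, by omega, -((1 - (n : ℤ)) / d), ?_⟩
      push_cast
      rw [Int.toNat_of_nonneg h1]
      linarith
    have hα := hn₀ N (hn.trans hnN) (by rw [hperiod]; exact hdvd)
    rw [PlaneTree.coeff_sizeSeries, Set.univ_inter, measureReal_def,
      Measure.map_apply_of_aemeasurable hτ.aemeasurable (PlaneTree.measurableSet_size_eq N)] at hα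
    refine (ENNReal.toReal_pos_iff.1 hα).1.trans_le (measure_mono fun ω hω => ?_)
    have hω : (τ ω).size = (N : ℕ∞) := hω
    simp only [Set.mem_ofPred_eq, hω]
    exact_mod_cast And.intro hnN hNd
  have hpos' : ∀ n : ℕ, 0 < P {ω | (n : ℕ∞) ≤ (τ ω).size} := by
    intro n
    obtain ⟨k, hk, hnk⟩ := (hpos.and (eventually_ge_atTop n)).exists
    refine hk.trans_le (measure_mono fun ω hω => ?_)
    exact le_trans (by exact_mod_cast hnk) hω.1
  refine ⟨⟨hpos, fun hlaw => ?_⟩, hpos', fun hlaw => ?_⟩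
  · refine tendstoInDistribution_kestenTree hp0 hp01 hm hτ hτ' hσ
      (E := fun n => {t | (n : ℕ∞) ≤ t.size ∧ t.size < (n : ℕ∞) + (d : ℕ∞)})
      (J := fun n => {N | n ≤ N ∧ N < n + d}) (fun n => ?_) (fun n N hN => hN.1) (fun n => ?_)
      hpos hlaw
    · have h2 := (PlaneTree.measurableSet_le_size (n + d)).compl
      have : {t : PlaneTree | ((n + d : ℕ) : ℕ∞) ≤ t.size}ᶜ =
          {t | t.size < (n : ℕ∞) + (d : ℕ∞)} := by
        ext t
        simp
      rw [this] at h2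
      exact (PlaneTree.measurableSet_le_size n).inter h2
    · refine Eventually.of_forall fun t => propext ⟨fun ht => ?_, ?_⟩
      · obtain ⟨N, hN⟩ := ENat.ne_top_iff_exists.1 (ne_top_of_lt ht.2)
        have ht1 := ht.1
        have ht2 := ht.2
        rw [← hN] at ht1 ht2
        exact ⟨N, ⟨by exact_mod_cast ht1, by exact_mod_cast ht2⟩, hN.symm⟩
      · rintro ⟨N, ⟨h1, h2⟩, hN⟩
        refine ⟨?_, ?_⟩
        · rw [hN]; exact_mod_cast h1
        · rw [hN]; exact_mod_cast h2
  · refine tendstoInDistribution_kestenTree hp0 hp01 hm hτ hτ' hσ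
      (E := fun n => {t | (n : ℕ∞) ≤ t.size}) (J := fun n => {N | n ≤ N})
      PlaneTree.measurableSet_le_size (fun n N hN => hN) (fun n => ?_)
      (Eventually.of_forall hpos') hlaw
    have hfin : ∀ᵐ t ∂(P.map τ), t.size ≠ ⊤ := by
      have := hμ.measure_size_eq_top hp01 hm
      rw [ae_iff]
      simpa using this
    filter_upwards [hfin] with t ht
    obtain ⟨N, hN⟩ := ENat.ne_top_iff_exists.1 ht
    refine propext ⟨fun hn => ?_, ?_⟩
    · have hn' : (n : ℕ∞) ≤ t.size := hn
      rw [← hN] at hn'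
      exact ⟨N, by exact_mod_cast hn', hN.symm⟩
    · rintro ⟨M, hM, hMt⟩
      change (n : ℕ∞) ≤ t.size
      rw [hMt]
      exact_mod_cast hM
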